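/- \emph{Setting.} JSON values are $\mathtt{null}$, booleans, decimal numbers, strings, arrays, and objects (finite maps from strings to JSON values). A schema of \emph{Static Modern JSON Schema} (a core of Draft 2020-12 without dynamic references) is $\mathtt{true}$, $\mathtt{false}$, or an object made of keywords with pairwise different names. The keywords are \texttt{minimum}, \texttt{maximum}, \texttt{pattern}, \texttt{const}, \texttt{type}, \texttt{anyOf}, \texttt{allOf}, \texttt{oneOf}, \texttt{not}, \texttt{patternProperties}, \texttt{properties}, \texttt{required}, \texttt{minProperties}, \texttt{maxProperties}, \texttt{propertyNames}, \texttt{prefixItems}, \texttt{contains}, \texttt{minItems}, \texttt{maxItems}, \texttt{uniqueItems}, \texttt{\$ref}, \texttt{\$defs}, \texttt{\$anchor}, \texttt{additionalProperties}, \texttt{items}, \texttt{unevaluatedProperties}, \texttt{unevaluatedItems}, and unlisted keywords, which are ignored. All references are local and refer to a schema that is present in the document, and recursion is guarded (no cycle of dependencies that passes only through \texttt{anyOf}, \texttt{allOf}, \texttt{oneOf}, \texttt{not} and \texttt{\$ref}). Validation of an instance returns a boolean and the set of the evaluated fields or items of the instance, as in Draft 2020-12; failing schemas return no evaluated field or item.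 \emph{Classical JSON Schema} is the sublanguage without \texttt{unevaluatedProperties} and \texttt{unevaluatedItems}. Two schemas are \emph{equivalent} if they are satisfied by the same JSON values. The \emph{size} of a schema is the number of symbols needed to write it (all characters of strings and patterns and all digits of numbers are counted); its \emph{number of keywords} is the number of occurrences of keywords in it, at any depth. \emph{Statement.} There is a family $(S_n)_{n\in\mathbb N}$ of schemas of Static Modern JSON Schema such that (a) for every $n$, the only occurrence in $S_n$ of one of the two Modern operators \texttt{unevaluatedProperties} and \texttt{unevaluatedItems} is a single occurrence of \texttt{unevaluatedProperties}; (b) $S_n$ has $O(n)$ keywords and size $O(n\log n)$; (c) every $S_n$ is equivalent to some schema of Classical JSON Schema; (d) for every family $(S'_n)_{n\in\mathbb N}$ of schemas of Classical JSON Schema such that $S'_n$ is equivalent to $S_n$ for every $n$, the number of keywords of $S'_n$ is in $\Omega(2^n)$, and hence the size of $S'_n$ is in $\Omega(2^n)$. -/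

import Mathlib

namespace JSchema

/-! ### JSON values -/

/-- Decimal numbers: the rationals that admit a finite decimal representation. -/
def DNum : Type := {q : ℚ // ∃ (k : ℕ) (z : ℤ), q * 10 ^ k = z}

/-- JSON values. An object is a finite set of field names together with a value for each name, so
names are distinct, the order of the fields is irrelevant, and equality of JSON values is `=`. -/
inductive JVal : Type
  | null : JVal
  | bool (b : Bool) : JVal
  | num (d : DNum) : JVal
  | str (s : String) : JVal
  | arr (n : ℕ) (items : Fin n → JVal) : JVal
  | obj (names : Finset String) (val : {k : String // k ∈ names} → JVal) : JVal

/-- The values of the keyword `type`. -/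
inductive Tp : Type
  | object | number | integer | string | array | boolean | null

/-- `J.HasType t`: the instance `J` has type `t` (every integer is also a number). -/
def JVal.HasType : JVal → Tp → Prop
  | .null, .null => True
  | .bool _, .boolean => True
  | .num _, .number => True
  | .num d, .integer => d.1.den = 1
  | .str _, .string => True
  | .arr _ _, .array => True
  | .obj _ _, .object => True
  | _, _ => False

/-! ### Patterns -/

/-- Extended regular expressions. A bracket expression is a list of character ranges, possibly
negated; `rep r lo hi` is `r{lo,hi}`, with `none` for a missing upper bound, so that it covers
`r*`, `r+`, `r?`, `r{m}`, `r{m,}` and `r{m,n}`; `bos` and `eos` are the anchors `^` and `$`. -/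
inductive Pattern : Type
  | empty : Pattern
  | char (c : Char) : Pattern
  | any : Pattern
  | bracket (neg : Bool) (ranges : List (Char × Char)) : Pattern
  | cat (p q : Pattern) : Pattern
  | alt (p q : Pattern) : Pattern
  | rep (p : Pattern) (lo : ℕ) (hi : Option ℕ) : Pattern
  | bos : Pattern
  | eos : Pattern

/-- `p.MatchAt s i j`: the pattern `p` matches the part of the text `s` between the positions
`i` and `j`. -/
def Pattern.MatchAt (s : List Char) : Pattern → ℕ → ℕ → Prop
  | .empty, i, j => j = i
  | .char c, i, j => j = i + 1 ∧ s[i]? = some c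
  | .any, i, j => j = i + 1 ∧ i < s.length
  | .bracket neg ranges, i, j => j = i + 1 ∧ ∃ c, s[i]? = some c ∧
      ((∃ ab ∈ ranges, ab.1 ≤ c ∧ c ≤ ab.2) ↔ neg = false)
  | .cat p q, i, j => ∃ m, p.MatchAt s i m ∧ q.MatchAt s m j
  | .alt p q, i, j => p.MatchAt s i j ∨ q.MatchAt s i j
  | .rep p lo hi, i, j => ∃ (c : ℕ) (f : ℕ → ℕ), lo ≤ c ∧ (∀ h ∈ hi, c ≤ h) ∧
      f 0 = i ∧ f c = j ∧ ∀ t < c, p.MatchAt s (f t) (f (t + 1))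
  | .bos, i, j => j = i ∧ i = 0
  | .eos, i, j => j = i ∧ i = s.length

/-- The language of a pattern: all strings that contain a match of it (an unanchored pattern may
match anywhere in the string). -/
def Pattern.lang (p : Pattern) : Set String :=
  {s | ∃ i j, i ≤ s.toList.length ∧ p.MatchAt s.toList i j}

/-! ### Schemas -/

/-- Local references: `#/$defs/name` and `#name`. -/
inductive Ref : Type
  | path (name : String) : Ref
  | anchor (name : String) : Ref

mutual

/-- Schemas of Static Modern JSON Schema. -/
inductive Schema : Type
  | bool (b : Bool) : Schema
  | obj (ks : List Keyword) : Schema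

/-- Keywords, that is, pairs of a keyword name and its argument. The name is the constructor;
`other k J` is a field whose name `k` is none of the names of the other constructors. -/
inductive Keyword : Type
  | minimum (d : DNum) : Keyword
  | maximum (d : DNum) : Keyword
  | pattern (p : Pattern) : Keyword
  | const (J : JVal) : Keyword
  | type (t : Tp) : Keyword
  | anyOf (Ss : List Schema) : Keyword
  | allOf (Ss : List Schema) : Keyword
  | oneOf (Ss : List Schema) : Keyword
  | not (S : Schema) : Keyword
  | patternProperties (ps : List (Pattern × Schema)) : Keyword
  | properties (ps : List (String × Schema)) : Keyword
  | required (names : List String) : Keyword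
  | minProperties (i : ℕ) : Keyword
  | maxProperties (i : ℕ) : Keyword
  | propertyNames (S : Schema) : Keyword
  | prefixItems (Ss : List Schema) : Keyword
  | contains (S : Schema) : Keyword
  | minItems (i : ℕ) : Keyword
  | maxItems (i : ℕ) : Keyword
  | uniqueItems (b : Bool) : Keyword
  | ref (u : Ref) : Keyword
  | defs (ds : List (String × Schema)) : Keyword
  | anchor (name : String) : Keyword
  | other (k : String) (J : JVal) : Keyword
  | additionalProperties (S : Schema) : Keyword
  | items (S : Schema) : Keyword
  | unevaluatedProperties (S : Schema) : Keyword
  | unevaluatedItems (S : Schema) : Keyword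

end

/-- The schemas that are immediate arguments of a keyword. -/
def Keyword.children : Keyword → List Schema
  | .anyOf Ss | .allOf Ss | .oneOf Ss | .prefixItems Ss => Ss
  | .not S | .propertyNames S | .contains S | .additionalProperties S | .items S
  | .unevaluatedProperties S | .unevaluatedItems S => [S]
  | .patternProperties ps => ps.map Prod.snd
  | .properties ps | .defs ps => ps.map Prod.snd
  | _ => []

/-- The syntactic classes of keywords: independent, statically dependent, annotation dependent. -/
def Keyword.phase : Keyword → ℕ
  | .additionalProperties _ | .items _ => 1
  | .unevaluatedProperties _ | .unevaluatedItems _ => 2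
  | _ => 0

def Keyword.IsIndependent (K : Keyword) : Prop := K.phase = 0

/-- Two keywords have the same name. -/
def Keyword.SameName : Keyword → Keyword → Prop
  | .other k _, .other k' _ => k = k'
  | K, K' => K.ctorIdx = K'.ctorIdx

/-! ### Weights of schemas -/

theorem sizeOf_snd_lt_of_mem {α : Type} [SizeOf α] {ps : List (α × Schema)} {S : Schema}
    (h : S ∈ ps.map Prod.snd) : sizeOf S < sizeOf ps := by
  obtain ⟨⟨a, T⟩, hp, rfl⟩ := List.mem_map.1 h
  have := List.sizeOf_lt_of_mem hp
  simp only [Prod.mk.sizeOf_spec] at this ⊢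
  omega

theorem Keyword.sizeOf_children {K : Keyword} {S : Schema} (h : S ∈ K.children) :
    sizeOf S < sizeOf K := by
  cases K <;> simp only [Keyword.children, List.mem_singleton, List.not_mem_nil] at h
  all_goals first
    | (subst h; simp +arith)
    | (have := List.sizeOf_lt_of_mem h; simp +arith; omega)
    | (have := sizeOf_snd_lt_of_mem h; simp +arith; omega)

/-- The total weight of a schema, over the occurrences in it of schemas (of weight `b` each) and of
keywords (of weight `w K` each). -/
def Schema.total (b : ℕ) (w : Keyword → ℕ) : Schema → ℕ
  | .bool _ => b
  | .obj ks => b + (ks.attach.map fun K =>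
      w K.1 + (K.1.children.attach.map fun S => Schema.total b w S.1).sum).sum
termination_by S => sizeOf S
decreasing_by
  have h1 := Keyword.sizeOf_children S.2
  have h2 := List.sizeOf_lt_of_mem K.2
  simp only [Schema.obj.sizeOf_spec]
  omega

theorem Schema.total_bool (b : ℕ) (w : Keyword → ℕ) (c : Bool) :
    (Schema.bool c).total b w = b := by
  rw [Schema.total]

theorem Schema.total_obj (b : ℕ) (w : Keyword → ℕ) (ks : List Keyword) :
    (Schema.obj ks).total b w =
      b + (ks.map fun K => w K + (K.children.map fun S => S.total b w).sum).sum := by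
  rw [Schema.total]
  simp only [List.attach_map_val (l := _) (f := fun S : Schema => S.total b w)]
  rw [List.attach_map_val (l := ks)
    (f := fun K => w K + (K.children.map fun S => S.total b w).sum)]

/-- The number of keyword occurrences in a schema, at any depth. -/
def Schema.keywordCount (S : Schema) : ℕ := S.total 0 fun _ => 1

/-- The number of decimal digits. -/
def natSize (n : ℕ) : ℕ := 1 + Nat.log 10 n

def DNum.size (d : DNum) : ℕ := natSize d.1.num.natAbs + natSize d.1.den

def JVal.size : JVal → ℕ
  | .null => 1
  | .bool _ => 1
  | .num d => d.size
  | .str s => 1 + s.length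
  | .arr _ f => 1 + ∑ i, (f i).size
  | .obj _ f => 1 + ∑ k, (1 + k.1.length + (f k).size)

def Pattern.size : Pattern → ℕ
  | .empty | .char _ | .any | .bos | .eos => 1
  | .bracket _ ranges => 1 + 2 * ranges.length
  | .cat p q | .alt p q => 1 + p.size + q.size
  | .rep p lo hi => 1 + p.size + natSize lo + (hi.map natSize).getD 0

/-- The number of symbols of a keyword outside its schema arguments, where the name of a listed
keyword counts as one symbol. -/
def Keyword.localSize : Keyword → ℕ
  | .minimum d | .maximum d => 1 + d.size
  | .pattern p => 1 + p.size
  | .const J => 1 + J.size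
  | .patternProperties ps => 1 + (ps.map fun p => p.1.size).sum
  | .properties ps | .defs ps => 1 + (ps.map fun p => 1 + p.1.length).sum
  | .required names => 1 + (names.map fun k => 1 + k.length).sum
  | .minProperties i | .maxProperties i | .minItems i | .maxItems i => 1 + natSize i
  | .ref (.path s) | .ref (.anchor s) | .anchor s => 1 + s.length
  | .other k J => 1 + k.length + J.size
  | _ => 1

/-- The size of a schema: the number of symbols needed to write it, with every character of a
string or of a pattern and every digit of a number counted. -/
def Schema.size (S : Schema) : ℕ := S.total 1 Keyword.localSize

open Classical in
/-- The number of occurrences, at any depth, of keywords with property `P`. -/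
noncomputable def Schema.count (P : Keyword → Prop) (S : Schema) : ℕ :=
  S.total 0 fun K => if P K then 1 else 0

/-! ### Well-formed schemas -/

/-- `S'` is a subschema of `S` (possibly `S` itself). -/
inductive Schema.IsSub (S : Schema) : Schema → Prop
  | refl : Schema.IsSub S S
  | step {ks : List Keyword} {K : Keyword} {S' : Schema} :
      Schema.IsSub S (.obj ks) → K ∈ ks → S' ∈ K.children → Schema.IsSub S S'

/-- Dereferencing in the document `D`: `#/$defs/nn` is the schema with name `nn` in the `$defs` of
the document, and `#aa` is the subschema of the document with top-level keyword `$anchor: aa`. -/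
def Deref (D : Schema) : Ref → Schema → Prop
  | .path nn, S => ∃ ks ds, D = .obj ks ∧ Keyword.defs ds ∈ ks ∧ (nn, S) ∈ ds
  | .anchor aa, S => D.IsSub S ∧ ∃ ks, S = .obj ks ∧ Keyword.anchor aa ∈ ks

/-- The boolean keywords. -/
def Keyword.IsBoolean : Keyword → Prop
  | .anyOf _ | .allOf _ | .oneOf _ | .not _ => True
  | _ => False

/-- `S'` immediately unguardedly depends on `S''`. -/
def DependsOn (D : Schema) (S' S'' : Schema) : Prop :=
  ∃ ks, S' = .obj ks ∧ ∃ K ∈ ks,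
    (K.IsBoolean ∧ S'' ∈ K.children) ∨ ∃ u, K = .ref u ∧ Deref D u S''

/-- The guarded recursion constraint. -/
def Guarded (D : Schema) : Prop :=
  ∀ S, D.IsSub S → ¬ Relation.TransGen (DependsOn D) S S

/-- Alphanumeric strings that start with a letter. -/
def IsPlainName (s : String) : Prop :=
  ∃ c l, s.toList = c :: l ∧ c.isAlpha = true ∧ ∀ x ∈ l, Char.isAlphanum x = true

/-- Objects that occur as arguments of a keyword have pairwise distinct field names, and the names
of anchors are plain. -/
def Keyword.ArgOk : Keyword → Prop
  | .patternProperties ps => (ps.map Prod.fst).Nodup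
  | .properties ps | .defs ps => (ps.map Prod.fst).Nodup
  | .anchor s => IsPlainName s
  | _ => True

/-- The valid closed schemas of Static Modern JSON Schema. -/
structure Schema.IsStaticModern (D : Schema) : Prop where
  /-- independent keywords come first, then the statically dependent ones, then the annotation
  dependent ones -/
  ordered : ∀ ks, D.IsSub (.obj ks) → ks.Pairwise fun K K' => K.phase ≤ K'.phase
  /-- adjacent keywords have different names -/
  distinct : ∀ ks, D.IsSub (.obj ks) → ks.Pairwise fun K K' => ¬ K.SameName K'
  args : ∀ ks, D.IsSub (.obj ks) → ∀ K ∈ ks, K.ArgOk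
  /-- no two anchors have the same name -/
  anchors : ∀ aa, D.count (fun K => K = .anchor aa) ≤ 1
  /-- every reference refers to a schema of the document -/
  closed : ∀ ks, D.IsSub (.obj ks) → ∀ u, Keyword.ref u ∈ ks → ∃ S, Deref D u S
  guarded : Guarded D

/-- Classical JSON Schema: Static Modern JSON Schema without annotation-dependent keywords. -/
def Schema.IsClassical (D : Schema) : Prop :=
  D.IsStaticModern ∧ D.count (fun K => K.phase = 2) = 0

/-! ### Validation -/

/-- Annotations: sets of evaluated field names and of evaluated item positions. -/
abbrev Annot : Type := Set (String ⊕ ℕ)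

/-- All the field names of an object, or all the item positions of an array. -/
def JVal.all : JVal → Annot
  | .obj names _ => {a | ∃ k ∈ names, a = .inl k}
  | .arr n _ => {a | ∃ i < n, a = .inr i}
  | _ => ∅

/-- The keywords whose behavior is defined by a condition on the instance. -/
def Keyword.IsTerminal : Keyword → Prop
  | .minimum _ | .maximum _ | .pattern _ | .const _ | .type _ | .required _ | .minProperties _
  | .maxProperties _ | .minItems _ | .maxItems _ | .uniqueItems _ => True
  | .defs _ | .anchor _ | .other _ _ => True
  | _ => False

/-- The condition of a terminal keyword. A keyword that refers to one type is satisfied by every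
instance of any other type; `$defs`, `$anchor` and unlisted keywords are always satisfied. -/
def Keyword.Cond : Keyword → JVal → Prop
  | .const Jc, J => J = Jc
  | .type t, J => J.HasType t
  | .minimum d, .num x => d.1 ≤ x.1
  | .maximum d, .num x => x.1 ≤ d.1
  | .pattern p, .str s => s ∈ p.lang
  | .required ks, .obj names _ => ∀ k ∈ ks, k ∈ names
  | .minProperties i, .obj names _ => i ≤ names.card
  | .maxProperties i, .obj names _ => names.card ≤ i
  | .uniqueItems true, .arr n f => ∀ i j : Fin n, i ≠ j → f i ≠ f j
  | .minItems i, .arr n _ => i ≤ n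
  | .maxItems i, .arr n _ => n ≤ i
  | _, _ => True

/-- The type to which a non-terminal structural keyword refers. -/
def Keyword.target : Keyword → Option Tp
  | .properties _ | .patternProperties _ | .propertyNames _ | .additionalProperties _
  | .unevaluatedProperties _ => some .object
  | .prefixItems _ | .contains _ | .items _ | .unevaluatedItems _ => some .array
  | _ => none

/-- The property names matched by a list of keywords through `properties` and
`patternProperties`. -/
def propsOf (ks : List Keyword) : Set String :=
  {k | (∃ ps, Keyword.properties ps ∈ ks ∧ k ∈ ps.map Prod.fst) ∨
       (∃ ps, Keyword.patternProperties ps ∈ ks ∧ ∃ p ∈ ps.map Prod.fst, k ∈ p.lang)}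

/-- The length of the argument of `prefixItems`, or zero when that keyword is absent. -/
def prefLenOf : List Keyword → ℕ
  | [] => 0
  | .prefixItems Ss :: _ => Ss.length
  | _ :: ks => prefLenOf ks

/-- What a validation judgment is about: a schema, a keyword, or a list of adjacent keywords. -/
inductive Subject : Type
  | schema (S : Schema) : Subject
  | keyword (K : Keyword) : Subject
  | list (ks : List Keyword) : Subject

/-- The validation judgments. `Judg D J X r κ`: in the document `D`, the validation of the instance
`J` by `X` returns the boolean `r` and the annotation `κ`. -/
inductive Judg (D : Schema) : JVal → Subject → Bool → Annot → Prop
  -- schemas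
  | boolSchema (J : JVal) (b : Bool) : Judg D J (.schema (.bool b)) b ∅
  | objSchemaT {J : JVal} {ks : List Keyword} {κ : Annot} :
      Judg D J (.list ks) true κ → Judg D J (.schema (.obj ks)) true κ
  | objSchemaF {J : JVal} {ks : List Keyword} {κ : Annot} :
      Judg D J (.list ks) false κ → Judg D J (.schema (.obj ks)) false ∅
  -- in-place keywords
  | anyOf {J : JVal} {Ss : List Schema} {r : Bool}
      (rs : Fin Ss.length → Bool) (σ : Fin Ss.length → Annot) :
      (∀ i, Judg D J (.schema Ss[i]) (rs i) (σ i)) →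
      (r = true ↔ ∃ i, rs i = true) →
      Judg D J (.keyword (.anyOf Ss)) r (⋃ i, σ i)
  | allOf {J : JVal} {Ss : List Schema} {r : Bool}
      (rs : Fin Ss.length → Bool) (σ : Fin Ss.length → Annot) :
      (∀ i, Judg D J (.schema Ss[i]) (rs i) (σ i)) →
      (r = true ↔ ∀ i, rs i = true) →
      Judg D J (.keyword (.allOf Ss)) r (⋃ i, σ i)
  | oneOf {J : JVal} {Ss : List Schema} {r : Bool}
      (rs : Fin Ss.length → Bool) (σ : Fin Ss.length → Annot) :
      (∀ i, Judg D J (.schema Ss[i]) (rs i) (σ i)) →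
      (r = true ↔ ∃! i, rs i = true) →
      Judg D J (.keyword (.oneOf Ss)) r (⋃ i, σ i)
  | not {J : JVal} {S : Schema} {r r' : Bool} {σ : Annot} :
      Judg D J (.schema S) r' σ → r = !r' → Judg D J (.keyword (.not S)) r σ
  | ref {J : JVal} {u : Ref} {S : Schema} {r : Bool} {σ : Annot} :
      Deref D u S → Judg D J (.schema S) r σ → Judg D J (.keyword (.ref u)) r σ
  -- terminal and trivially satisfied keywords
  | terminal {J : JVal} {K : Keyword} {r : Bool} :
      K.IsTerminal → (r = true ↔ K.Cond J) → Judg D J (.keyword K) r ∅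
  | trivial {J : JVal} {K : Keyword} {t : Tp} :
      K.IsIndependent → K.target = some t → ¬ J.HasType t → Judg D J (.keyword K) true ∅
  -- structural keywords
  | propertyNames {names : Finset String} {val : {k : String // k ∈ names} → JVal} {S : Schema}
      {r : Bool} (rs : {k : String // k ∈ names} → Bool)
      (σ : {k : String // k ∈ names} → Annot) :
      (∀ k, Judg D (.str k.1) (.schema S) (rs k) (σ k)) →
      (r = true ↔ ∀ k, rs k = true) →
      Judg D (.obj names val) (.keyword (.propertyNames S)) r ∅
  | properties {names : Finset String} {val : {k : String // k ∈ names} → JVal}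
      {ps : List (String × Schema)} {r : Bool}
      (rs : {k : String // k ∈ names} → Fin ps.length → Bool)
      (σ : {k : String // k ∈ names} → Fin ps.length → Annot) :
      (∀ k j, k.1 = ps[j].1 → Judg D (val k) (.schema ps[j].2) (rs k j) (σ k j)) →
      (r = true ↔ ∀ k j, k.1 = ps[j].1 → rs k j = true) →
      Judg D (.obj names val) (.keyword (.properties ps)) r
        {a | ∃ k ∈ names, a = .inl k ∧ ∃ j : Fin ps.length, k = ps[j].1}
  | patternProperties {names : Finset String} {val : {k : String // k ∈ names} → JVal}
      {ps : List (Pattern × Schema)} {r : Bool}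
      (rs : {k : String // k ∈ names} → Fin ps.length → Bool)
      (σ : {k : String // k ∈ names} → Fin ps.length → Annot) :
      (∀ k j, k.1 ∈ ps[j].1.lang → Judg D (val k) (.schema ps[j].2) (rs k j) (σ k j)) →
      (r = true ↔ ∀ k j, k.1 ∈ ps[j].1.lang → rs k j = true) →
      Judg D (.obj names val) (.keyword (.patternProperties ps)) r
        {a | ∃ k ∈ names, a = .inl k ∧ ∃ j : Fin ps.length, k ∈ ps[j].1.lang}
  | prefixItems {n : ℕ} {f : Fin n → JVal} {Ss : List Schema} {r : Bool}
      (rs : Fin n → Bool) (σ : Fin n → Annot) :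
      (∀ (i : Fin n) (h : i.1 < Ss.length), Judg D (f i) (.schema Ss[i.1]) (rs i) (σ i)) →
      (r = true ↔ ∀ i : Fin n, i.1 < Ss.length → rs i = true) →
      Judg D (.arr n f) (.keyword (.prefixItems Ss)) r {a | ∃ i < min Ss.length n, a = .inr i}
  | contains {n : ℕ} {f : Fin n → JVal} {S : Schema} {r : Bool}
      (rs : Fin n → Bool) (σ : Fin n → Annot) :
      (∀ i, Judg D (f i) (.schema S) (rs i) (σ i)) →
      (r = true ↔ ∃ i, rs i = true) →
      Judg D (.arr n f) (.keyword (.contains S)) r {a | ∃ i, rs i = true ∧ a = .inr i.1}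
  -- lists of keywords
  | nil (J : JVal) : Judg D J (.list []) true ∅
  | independent {J : JVal} {ks : List Keyword} {K : Keyword} {r₀ r₁ r : Bool} {κ₀ κ₁ : Annot} :
      K.IsIndependent →
      Judg D J (.list ks) r₀ κ₀ → Judg D J (.keyword K) r₁ κ₁ →
      r = (r₀ && r₁) →
      Judg D J (.list (ks ++ [K])) r (κ₀ ∪ κ₁)
  | trivialDependent {J : JVal} {ks : List Keyword} {K : Keyword} {t : Tp} {r : Bool} {κ : Annot} :
      ¬ K.IsIndependent → K.target = some t → ¬ J.HasType t →
      Judg D J (.list ks) r κ →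
      Judg D J (.list (ks ++ [K])) r κ
  | additionalProperties {names : Finset String} {val : {k : String // k ∈ names} → JVal}
      {ks : List Keyword} {S : Schema} {r₀ r : Bool} {κ : Annot}
      (rs : {k : String // k ∈ names} → Bool) (σ : {k : String // k ∈ names} → Annot) :
      Judg D (.obj names val) (.list ks) r₀ κ →
      (∀ k, k.1 ∉ propsOf ks → Judg D (val k) (.schema S) (rs k) (σ k)) →
      (r = true ↔ r₀ = true ∧ ∀ k, k.1 ∉ propsOf ks → rs k = true) →
      Judg D (.obj names val) (.list (ks ++ [.additionalProperties S])) r (JVal.obj names val).all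
  | unevaluatedProperties {names : Finset String} {val : {k : String // k ∈ names} → JVal}
      {ks : List Keyword} {S : Schema} {r₀ r : Bool} {κ : Annot}
      (rs : {k : String // k ∈ names} → Bool) (σ : {k : String // k ∈ names} → Annot) :
      Judg D (.obj names val) (.list ks) r₀ κ →
      (∀ k, .inl k.1 ∉ κ → Judg D (val k) (.schema S) (rs k) (σ k)) →
      (r = true ↔ r₀ = true ∧ ∀ k, .inl k.1 ∉ κ → rs k = true) →
      Judg D (.obj names val) (.list (ks ++ [.unevaluatedProperties S])) r (JVal.obj names val).all
  | items {n : ℕ} {f : Fin n → JVal} {ks : List Keyword} {S : Schema} {r₀ r : Bool} {κ : Annot}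
      (rs : Fin n → Bool) (σ : Fin n → Annot) :
      Judg D (.arr n f) (.list ks) r₀ κ →
      (∀ i : Fin n, prefLenOf ks ≤ i.1 → Judg D (f i) (.schema S) (rs i) (σ i)) →
      (r = true ↔ r₀ = true ∧ ∀ i : Fin n, prefLenOf ks ≤ i.1 → rs i = true) →
      Judg D (.arr n f) (.list (ks ++ [.items S])) r (JVal.arr n f).all
  | unevaluatedItems {n : ℕ} {f : Fin n → JVal} {ks : List Keyword} {S : Schema} {r₀ r : Bool}
      {κ : Annot} (rs : Fin n → Bool) (σ : Fin n → Annot) :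
      Judg D (.arr n f) (.list ks) r₀ κ →
      (∀ i : Fin n, .inr i.1 ∉ κ → Judg D (f i) (.schema S) (rs i) (σ i)) →
      (r = true ↔ r₀ = true ∧ ∀ i : Fin n, .inr i.1 ∉ κ → rs i = true) →
      Judg D (.arr n f) (.list (ks ++ [.unevaluatedItems S])) r (JVal.arr n f).all

/-- The instance `J` satisfies the schema `S`, taken as the current document. -/
def Schema.Validates (S : Schema) (J : JVal) : Prop := ∃ κ, Judg S J (.schema S) true κ

/-- Equivalent schemas are satisfied by the same instances. -/
def Schema.Equivalent (S T : Schema) : Prop := ∀ J, S.Validates J ↔ T.Validates J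

/-- The only Modern keyword in `S` is one occurrence of `unevaluatedProperties`. -/
def Schema.OneUnevaluatedProperties (S : Schema) : Prop :=
  S.count (fun K => ∃ T, K = .unevaluatedProperties T) = 1 ∧ S.count (fun K => K.phase = 2) = 1

end JSchema

/-!
The schema `modernSchema n` has `2 * n` branches below `anyOf`, one for each position `i < n` and
each binary digit `c`. If a flag, that is, a field with a name that depends on `(i, c)`, is present,
then its branch evaluates all fields whose name has the digit `c` at position `i`. By
`unevaluatedProperties`, the other fields have to be `null`. A classical schema can guess the set of
the flags that are present: `classicalSchema n` has a branch for each of the `2 ^ (2 * n)` sets.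
A guess that is too small only forbids more, so that some guess works if and only if the set of all
flags that are present does.

For the lower bound, consider the objects that have all binary words of length `n` among their
fields, where the words in a set `A` have the value `true` and all other fields are `null`. For a
word `w`, let the flags be those of the pairs `(i, c)` where `c` is not the digit of `w` at `i`.
These flags evaluate all words except for `w`, so that the object satisfies `modernSchema n` if and
only if `w ∉ A` (`validates_modernSchema_inst`). An equivalent schema thus tells any two sets `A`
apart, once the flags are suitably chosen.

In a classical schema, however, each keyword learns very little about `A`. Boolean keywords and
references only combine results for the same instance; keywords such as `required` only see the
names of the fields; `const` accepts a single instance; and `properties`,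
`patternProperties` and `additionalProperties` return a conjunction over all fields, whose
part over the words depends on `A` but not on the flags, while the part over the
flags does not depend on `A`. Hence two bits for each occurrence of a keyword, its `code`,
determine the result of the whole validation for every choice of the flags
(`Judg.transfer`). There are `2 ^ 2 ^ n` sets `A`, and so at least `2 ^ n / 2` keywords
(`card_le_two_mul_keywordCount`). This argument sees a document as a set of keyword occurrences, and
so it is not affected by sharing through references. It turns one derivation of a validation
judgment into another one, and so it needs neither that results are unique nor that they exist:
this is why the two bits are the two possible results of a keyword on the words, and not just one
truth value.
-/

namespace JSchema

/-! ### Subschemas and occurrences of keywords -/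

/-- Subschemas, decomposed from the root instead of from the leaves. -/
theorem Schema.IsSub.cases_head {D S : Schema} (h : D.IsSub S) :
    S = D ∨ ∃ ks, D = .obj ks ∧ ∃ K ∈ ks, ∃ C ∈ K.children, C.IsSub S := by
  induction h with
  | refl => exact Or.inl rfl
  | step _ hK hC ih =>
    right
    rcases ih with rfl | ⟨ks', rfl, K', hK', C', hC', h'⟩
    · exact ⟨_, rfl, _, hK, _, hC, .refl⟩
    · exact ⟨ks', rfl, K', hK', C', hC', h'.step hK hC⟩

theorem Deref.isSub {D S : Schema} {u : Ref} (h : Deref D u S) : D.IsSub S := by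
  cases u with
  | path nn =>
    obtain ⟨ks, ds, rfl, hds, hmem⟩ := h
    exact .step .refl hds (List.mem_map_of_mem hmem)
  | anchor aa => exact h.1

theorem Schema.le_total_of_mem {b : ℕ} {w : Keyword → ℕ} {ks : List Keyword} {K : Keyword}
    (hK : K ∈ ks) :
    w K + (K.children.map fun S => S.total b w).sum ≤ (Schema.obj ks).total b w := by
  rw [Schema.total_obj]
  exact le_add_left (List.single_le_sum (by simp) _ (List.mem_map_of_mem hK))

theorem Schema.IsSub.total_le {D S : Schema} (h : D.IsSub S) (b : ℕ) (w : Keyword → ℕ) :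
    S.total b w ≤ D.total b w := by
  induction h with
  | refl => exact le_rfl
  | step _ hK hC ih =>
    refine le_trans ?_ ((Schema.le_total_of_mem hK).trans ih)
    exact le_add_left (List.single_le_sum (by simp) _
      (List.mem_map_of_mem (f := fun S : Schema => S.total b w) hC))

theorem Schema.not_of_count_eq_zero {P : Keyword → Prop} {D : Schema} (h : D.count P = 0)
    {ks : List Keyword} (hks : D.IsSub (.obj ks)) {K : Keyword} (hK : K ∈ ks) : ¬ P K := by
  intro hP
  have h1 := hks.total_le 0 (fun K => open Classical in if P K then 1 else 0)
  have h2 := Schema.le_total_of_mem (b := 0)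
    (w := fun K => open Classical in if P K then 1 else 0) hK
  rw [if_pos hP] at h2
  unfold Schema.count at h
  omega

/-- In `D`, the keyword `K` occurs immediately after the list `l` of adjacent keywords. -/
def Occurs (D : Schema) (l : List Keyword) (K : Keyword) : Prop :=
  ∃ ks, D.IsSub (.obj ks) ∧ l ++ [K] <+: ks

theorem exists_list_of_forall_mem {α β : Type*} {Q : α → β → Prop} {w : α → ℕ} (xs : List α)
    (h : ∀ x ∈ xs, ∃ L : List β, (∀ p, Q x p → p ∈ L) ∧ L.length ≤ w x) :
    ∃ L : List β, (∀ p, (∃ x ∈ xs, Q x p) → p ∈ L) ∧ L.length ≤ (xs.map w).sum := by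
  induction xs with
  | nil => exact ⟨[], by simp, by simp⟩
  | cons x xs ih =>
    obtain ⟨L₁, h₁, l₁⟩ := h x (by simp)
    obtain ⟨L₂, h₂, l₂⟩ := ih fun y hy => h y (by simp [hy])
    refine ⟨L₁ ++ L₂, ?_, by simp; omega⟩
    rintro p ⟨y, hy, hp⟩
    rcases List.mem_cons.1 hy with rfl | hy
    · exact List.mem_append_left _ (h₁ p hp)
    · exact List.mem_append_right _ (h₂ p ⟨y, hy, hp⟩)

/-- A schema has at most `keywordCount` many pairs of a keyword and the list of the keywords that
precede it. -/
theorem exists_list_occurs (D : Schema) :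
    ∃ L : List (List Keyword × Keyword),
      (∀ p, Occurs D p.1 p.2 → p ∈ L) ∧ L.length ≤ D.keywordCount := by
  match D with
  | .bool b =>
    refine ⟨[], ?_, by simp⟩
    rintro p ⟨ks, hs, -⟩
    rcases hs.cases_head with h | ⟨ks, h, -⟩ <;> cases h
  | .obj ks =>
    have hrec : ∀ K ∈ ks, ∃ L : List (List Keyword × Keyword),
        (∀ p, (∃ C ∈ K.children, Occurs C p.1 p.2) → p ∈ L) ∧
          L.length ≤ (K.children.map fun S => S.total 0 fun _ => 1).sum :=
      fun K hK => exists_list_of_forall_mem _ fun C hC => exists_list_occurs C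
    obtain ⟨L, hL, hlen⟩ := exists_list_of_forall_mem ks hrec
    refine ⟨ks.zipIdx.map (fun x => (ks.take x.2, x.1)) ++ L, ?_, ?_⟩
    · rintro ⟨l, K⟩ ⟨ks', hs, t, ht⟩
      rcases hs.cases_head with h | ⟨ks₁, h, K₁, hK₁, C, hC, hsub⟩
      · cases h
        refine List.mem_append_left _ (List.mem_map.2 ⟨(K, l.length), ?_, ?_⟩)
        · rw [List.mem_zipIdx_iff_getElem?, ← ht]
          simp
        · simp [← ht]
      · cases h
        exact List.mem_append_right _ (hL _ ⟨K₁, hK₁, C, hC, ks', hsub, t, ht⟩)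
    · rw [Schema.keywordCount, Schema.total_obj, List.sum_map_add]
      simp only [List.length_append, List.length_map, List.length_zipIdx, List.map_const',
        List.sum_replicate, smul_eq_mul, mul_one, zero_add]
      omega
termination_by sizeOf D
decreasing_by
  have h1 := Keyword.sizeOf_children hC
  have h2 := List.sizeOf_lt_of_mem hK
  simp only [Schema.obj.sizeOf_spec]
  omega

/-! ### Outcomes of the keywords that apply schemas to the fields of an object -/

/-- The keyword `K`, preceded by the keywords `l`, applies the schema `S` to the value of any field
with name `k`. -/
def Applies (l : List Keyword) : Keyword → String → Schema → Prop
  | .properties ps, k, S => (k, S) ∈ ps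
  | .patternProperties ps, k, S => ∃ p, (p, S) ∈ ps ∧ k ∈ p.lang
  | .additionalProperties T, k, S => k ∉ propsOf l ∧ S = T
  | _, _, _ => False

/-- The conjunction of the applications of the schemas `S` with `R k S` to the fields `k ∈ N`, with
values `v k`, has the result `r`. As for validation itself, each of these applications has to
return some result. -/
def Outcome (D : Schema) (R : String → Schema → Prop) (N : Finset String) (v : String → JVal)
    (r : Bool) : Prop :=
  (∀ k ∈ N, ∀ S, R k S →
    ∃ r' κ, Judg D (v k) (.schema S) r' κ ∧ (r = true → r' = true)) ∧
  (r = false → ∃ k ∈ N, ∃ S, R k S ∧ ∃ κ, Judg D (v k) (.schema S) false κ)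

/-- Results and annotations of a family of validations, chosen so that their conjunction is `r`. -/
theorem exists_family_iff {ι : Type*} {P : ι → Prop} {Q : ι → Bool → Annot → Prop} {r : Bool} :
    (∃ (rs : ι → Bool) (σ : ι → Annot), (∀ x, P x → Q x (rs x) (σ x)) ∧
      (r = true ↔ ∀ x, P x → rs x = true)) ↔
    (∀ x, P x → ∃ r' κ, Q x r' κ ∧ (r = true → r' = true)) ∧
      (r = false → ∃ x, P x ∧ ∃ κ, Q x false κ) := by
  constructor
  · rintro ⟨rs, σ, h, hr⟩
    refine ⟨fun x hx => ⟨_, _, h x hx, fun h' => hr.1 h' x hx⟩, fun h' => ?_⟩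
    subst h'
    by_contra! hc
    refine Bool.false_ne_true (hr.2 fun x hx => ?_)
    by_contra hx'
    rw [Bool.not_eq_true] at hx'
    exact hc x hx _ (hx' ▸ h x hx)
  · rintro ⟨h₁, h₂⟩
    cases r with
    | true =>
      have : ∀ x, ∃ r' κ, P x → Q x r' κ ∧ r' = true := fun x => by
        by_cases hx : P x
        · obtain ⟨r', κ, h⟩ := h₁ x hx
          exact ⟨r', κ, fun _ => ⟨h.1, h.2 rfl⟩⟩
        · exact ⟨true, ∅, fun h => absurd h hx⟩
      choose rs σ h using this
      exact ⟨rs, σ, fun x hx => (h x hx).1, by simpa using fun x hx => (h x hx).2⟩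
    | false =>
      obtain ⟨x₀, hx₀, κ₀, h₀⟩ := h₂ rfl
      have : ∀ x, ∃ r' κ, P x → Q x r' κ ∧ (x = x₀ → r' = false) := fun x => by
        by_cases hx : P x
        · by_cases hxx : x = x₀
          · exact ⟨false, κ₀, fun _ => ⟨hxx ▸ h₀, fun _ => rfl⟩⟩
          · obtain ⟨r', κ, h⟩ := h₁ x hx
            exact ⟨r', κ, fun _ => ⟨h.1, fun h => absurd h hxx⟩⟩
        · exact ⟨true, ∅, fun h => absurd h hx⟩
      choose rs σ h using this
      refine ⟨rs, σ, fun x hx => (h x hx).1, by simp, fun hall => ?_⟩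
      simpa [hall x₀ hx₀] using (h x₀ hx₀).2 rfl

/-- The result of `properties` is an outcome in which the preceding keywords `l` play no role. -/
theorem exists_judg_properties_iff {D : Schema} {N : Finset String} {v : String → JVal}
    {ps : List (String × Schema)} {l : List Keyword} {r : Bool} :
    (∃ κ, Judg D (.obj N fun k => v k.1) (.keyword (.properties ps)) r κ) ↔
      Outcome D (Applies l (.properties ps)) N v r := by
  have key := exists_family_iff (ι := {k : String // k ∈ N} × Fin ps.length)
    (P := fun x => x.1.1 = ps[x.2].1)
    (Q := fun x => Judg D (v x.1.1) (.schema ps[x.2].2)) (r := r)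
  have hout : Outcome D (Applies l (.properties ps)) N v r ↔
      (∀ x : {k : String // k ∈ N} × Fin ps.length, x.1.1 = ps[x.2].1 →
        ∃ r' κ, Judg D (v x.1.1) (.schema ps[x.2].2) r' κ ∧ (r = true → r' = true)) ∧
      (r = false → ∃ x : {k : String // k ∈ N} × Fin ps.length, x.1.1 = ps[x.2].1 ∧
        ∃ κ, Judg D (v x.1.1) (.schema ps[x.2].2) false κ) := by
    unfold Outcome
    simp only [Applies]
    refine and_congr ⟨?_, ?_⟩ (imp_congr_right fun _ => ⟨?_, ?_⟩)
    · rintro h ⟨k, j⟩ hk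
      refine h k.1 k.2 _ ?_
      dsimp only at hk
      rw [hk]
      exact List.getElem_mem j.2
    · intro h k hk S hS
      obtain ⟨j, hj, hjS⟩ := List.getElem_of_mem hS
      have := h (⟨k, hk⟩, ⟨j, hj⟩) (by simp [hjS])
      simpa [hjS] using this
    · rintro ⟨k, hk, S, hS, κ, h⟩
      obtain ⟨j, hj, hjS⟩ := List.getElem_of_mem hS
      exact ⟨(⟨k, hk⟩, ⟨j, hj⟩), by simp [hjS], κ, by simpa [hjS] using h⟩
    · rintro ⟨⟨k, j⟩, hk, κ, h⟩
      refine ⟨k.1, k.2, _, ?_, κ, h⟩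
      dsimp only at hk
      rw [hk]
      exact List.getElem_mem j.2
  rw [hout, ← key]
  constructor
  · rintro ⟨κ, h⟩
    cases h with
    | properties rs σ h hr =>
      exact ⟨fun x => rs x.1 x.2, fun x => σ x.1 x.2, fun x hx => h _ _ hx,
        hr.trans ⟨fun h x => h _ _, fun h k j => h (k, j)⟩⟩
    | terminal h _ => exact h.elim
    | trivial _ h h' => cases h; exact absurd (by trivial) h'
  · rintro ⟨rs, σ, h, hr⟩
    exact ⟨_, .properties (fun k j => rs (k, j)) (fun k j => σ (k, j)) (fun k j => h (k, j))
      (hr.trans ⟨fun h k j => h (k, j), fun h x => h _ _⟩)⟩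

/-- The result of `patternProperties` is an outcome in which the preceding keywords `l` play no
role. -/
theorem exists_judg_patternProperties_iff {D : Schema} {N : Finset String} {v : String → JVal}
    {ps : List (Pattern × Schema)} {l : List Keyword} {r : Bool} :
    (∃ κ, Judg D (.obj N fun k => v k.1) (.keyword (.patternProperties ps)) r κ) ↔
      Outcome D (Applies l (.patternProperties ps)) N v r := by
  have key := exists_family_iff (ι := {k : String // k ∈ N} × Fin ps.length)
    (P := fun x => x.1.1 ∈ ps[x.2].1.lang)
    (Q := fun x => Judg D (v x.1.1) (.schema ps[x.2].2)) (r := r)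
  have hout : Outcome D (Applies l (.patternProperties ps)) N v r ↔
      (∀ x : {k : String // k ∈ N} × Fin ps.length, x.1.1 ∈ ps[x.2].1.lang →
        ∃ r' κ, Judg D (v x.1.1) (.schema ps[x.2].2) r' κ ∧ (r = true → r' = true)) ∧
      (r = false → ∃ x : {k : String // k ∈ N} × Fin ps.length, x.1.1 ∈ ps[x.2].1.lang ∧
        ∃ κ, Judg D (v x.1.1) (.schema ps[x.2].2) false κ) := by
    unfold Outcome
    simp only [Applies]
    refine and_congr ⟨?_, ?_⟩ (imp_congr_right fun _ => ⟨?_, ?_⟩)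
    · rintro h ⟨k, j⟩ hk
      exact h k.1 k.2 _ ⟨_, List.getElem_mem j.2, hk⟩
    · rintro h k hk S ⟨p, hp, hkp⟩
      obtain ⟨j, hj, hjS⟩ := List.getElem_of_mem hp
      have := h (⟨k, hk⟩, ⟨j, hj⟩) (by simpa [hjS] using hkp)
      simpa [hjS] using this
    · rintro ⟨k, hk, S, ⟨p, hp, hkp⟩, κ, h⟩
      obtain ⟨j, hj, hjS⟩ := List.getElem_of_mem hp
      exact ⟨(⟨k, hk⟩, ⟨j, hj⟩), by simpa [hjS] using hkp, κ, by simpa [hjS] using h⟩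
    · rintro ⟨⟨k, j⟩, hk, κ, h⟩
      exact ⟨k.1, k.2, _, ⟨_, List.getElem_mem j.2, hk⟩, κ, h⟩
  rw [hout, ← key]
  constructor
  · rintro ⟨κ, h⟩
    cases h with
    | patternProperties rs σ h hr =>
      exact ⟨fun x => rs x.1 x.2, fun x => σ x.1 x.2, fun x hx => h _ _ hx,
        hr.trans ⟨fun h x => h _ _, fun h k j => h (k, j)⟩⟩
    | terminal h _ => exact h.elim
    | trivial _ h h' => cases h; exact absurd (by trivial) h'
  · rintro ⟨rs, σ, h, hr⟩
    exact ⟨_, .patternProperties (fun k j => rs (k, j)) (fun k j => σ (k, j))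
      (fun k j => h (k, j)) (hr.trans ⟨fun h k j => h (k, j), fun h x => h _ _⟩)⟩

theorem outcome_additionalProperties_iff {D : Schema} {N : Finset String} {v : String → JVal}
    {S : Schema} {l : List Keyword} {r : Bool} :
    Outcome D (Applies l (.additionalProperties S)) N v r ↔
      ∃ (rs : {k : String // k ∈ N} → Bool) (σ : {k : String // k ∈ N} → Annot),
        (∀ k, k.1 ∉ propsOf l → Judg D (v k.1) (.schema S) (rs k) (σ k)) ∧
        (r = true ↔ ∀ k, k.1 ∉ propsOf l → rs k = true) := by
  rw [exists_family_iff (P := fun k : {k : String // k ∈ N} => k.1 ∉ propsOf l)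
    (Q := fun k => Judg D (v k.1) (.schema S))]
  unfold Outcome
  simp [Applies, and_left_comm]

/-- The outcome on the fields in `N ∪ B` only depends on the two possible outcomes on the fields
in `N` and on the values of the other fields. -/
theorem Outcome.transfer {D : Schema} {R : String → Schema → Prop} {N B : Finset String}
    {v v' : String → JVal} {r : Bool} (h : Outcome D R (N ∪ B) v r) (hv : ∀ k ∉ N, v k = v' k)
    (hN : ∀ b, Outcome D R N v b → Outcome D R N v' b) : Outcome D R (N ∪ B) v' r := by
  have hdef : ∀ b, Outcome D R N v b → (r = true → b = true) → ∀ k ∈ N ∪ B, ∀ S, R k S →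
      ∃ r' κ, Judg D (v' k) (.schema S) r' κ ∧ (r = true → r' = true) := by
    intro b hb hrb k hk S hS
    by_cases hkN : k ∈ N
    · obtain ⟨r', κ, h₁, h₂⟩ := (hN b hb).1 k hkN S hS
      exact ⟨r', κ, h₁, fun hr => h₂ (hrb hr)⟩
    · rw [← hv k hkN]
      exact h.1 k hk S hS
  have hsub : ∀ k ∈ N, ∀ S, R k S →
      ∃ r' κ, Judg D (v k) (.schema S) r' κ ∧ (r = true → r' = true) :=
    fun k hk => h.1 k (Finset.mem_union_left _ hk)
  by_cases hf : ∃ k ∈ N, ∃ S, R k S ∧ ∃ κ, Judg D (v k) (.schema S) false κ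
  · cases r with
    | true =>
      have ht : Outcome D R N v true := ⟨hsub, by simp⟩
      exact ⟨hdef true ht (by simp), by simp⟩
    | false =>
      have ht : Outcome D R N v false := ⟨hsub, fun _ => hf⟩
      refine ⟨hdef false ht (by simp), fun _ => ?_⟩
      obtain ⟨k, hk, h'⟩ := (hN false ht).2 rfl
      exact ⟨k, Finset.mem_union_left _ hk, h'⟩
  · have ht : Outcome D R N v true := by
      refine ⟨fun k hk S hS => ?_, by simp⟩
      obtain ⟨r', κ, h₁, -⟩ := hsub k hk S hS
      cases r' with
      | true => exact ⟨true, κ, h₁, by simp⟩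
      | false => exact absurd ⟨k, hk, S, hS, κ, h₁⟩ hf
    refine ⟨hdef true ht (by simp), fun hr => ?_⟩
    obtain ⟨k, hk, S, hS, κ, h'⟩ := h.2 hr
    have hkN : k ∉ N := fun hkN => hf ⟨k, hkN, S, hS, κ, h'⟩
    exact ⟨k, hk, S, hS, κ, hv k hkN ▸ h'⟩

/-! ### Instances that a classical schema with few keywords does not tell apart -/

/-- The value of the field `k`: `true` for `k ∈ A`, and `null` otherwise. -/
def mark (A : Finset String) (k : String) : JVal := if k ∈ A then .bool true else .null

/-- The object with field names `N ∪ B`, where the fields in `A` have the value `true` and the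
other ones the value `null`. -/
def inst (N B A : Finset String) : JVal := .obj (N ∪ B) fun k => mark A k.1

/-- All that a keyword `K`, preceded by `l`, finds out about `A` in `inst N B A`, for any `B`. The
second conjunct of the first component deals with `const`, which sees the whole instance. -/
def code (D : Schema) (N A : Finset String) (l : List Keyword) (K : Keyword) : Prop × Prop :=
  (Outcome D (Applies l K) N (mark A) true ∧ ¬ ∃ B, K = .const (inst N B A),
    Outcome D (Applies l K) N (mark A) false)

/-- The subject of a judgment occurs in `D`. -/
def Within (D : Schema) : Subject → Prop
  | .schema S => D.IsSub S
  | .keyword K => ∃ l, Occurs D l K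
  | .list l => ∃ ks, D.IsSub (.obj ks) ∧ l <+: ks

theorem Occurs.isSub {D : Schema} {l : List Keyword} {K : Keyword} (h : Occurs D l K)
    {S : Schema} (hS : S ∈ K.children) : D.IsSub S := by
  obtain ⟨ks, h, hp⟩ := h
  exact h.step (hp.subset (by simp)) hS

theorem cond_obj_iff {N : Finset String} {f g : {k : String // k ∈ N} → JVal} {K : Keyword}
    (hK : ∀ J, K ≠ .const J) : K.Cond (.obj N f) ↔ K.Cond (.obj N g) := by
  cases K with
  | const J => exact absurd rfl (hK J)
  | uniqueItems b => cases b <;> exact Iff.rfl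
  | type t => cases t <;> exact Iff.rfl
  | _ => exact Iff.rfl

/-- A constant that is one of the instances fixes their field names, so it is the same instance for
the same `B`. -/
theorem inst_eq_of_const {N B B' A A' : Finset String} (h : inst N B A = inst N B' A') :
    inst N B A' = inst N B A := by
  have hB : N ∪ B = N ∪ B' := by injection h
  rw [h, inst, inst, hB]

/-- If all keywords of a document without annotation-dependent keywords find out the same about `A`
and `A'`, then validation in this document does not tell `inst N B A` from `inst N B A'`. -/
theorem Judg.transfer {D : Schema} (hD : D.count (fun K => K.phase = 2) = 0)
    {N B A A' : Finset String} (hA : A ⊆ N) (hA' : A' ⊆ N)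
    (hcode : ∀ l K, Occurs D l K → code D N A l K = code D N A' l K)
    {J : JVal} {X : Subject} {r : Bool} {κ : Annot} (h : Judg D J X r κ)
    (hJ : J = inst N B A) (hX : Within D X) : ∃ κ', Judg D (inst N B A') X r κ' := by
  have hmark : ∀ k ∉ N, mark A k = mark A' k := fun k hk => by
    rw [mark, mark, if_neg fun h => hk (hA h), if_neg fun h => hk (hA' h)]
  have hstruct : ∀ l K, Occurs D l K → (∀ J, K ≠ .const J) → ∀ r,
      Outcome D (Applies l K) (N ∪ B) (mark A) r →
        Outcome D (Applies l K) (N ∪ B) (mark A') r := by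
    intro l K ho hK r hr
    refine hr.transfer hmark fun b hb => ?_
    have hc := Prod.ext_iff.1 (hcode l K ho)
    cases b with
    | true =>
      have h₁ := hc.1
      simp only [code, eq_iff_iff] at h₁
      exact (h₁.1 ⟨hb, fun ⟨_, h⟩ => hK _ h⟩).1
    | false => exact (eq_iff_iff.1 hc.2).1 hb
  have htype : ∀ t, (inst N B A).HasType t ↔ (inst N B A').HasType t := fun t => by
    cases t <;> exact Iff.rfl
  have hphase : ∀ ks K, D.IsSub (.obj ks) → K ∈ ks → K.phase ≠ 2 := fun ks K h hK =>
    Schema.not_of_count_eq_zero hD h hK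
  have hprefix : ∀ ks (K : Keyword), Within D (.list (ks ++ [K])) →
      Within D (.list ks) ∧ Occurs D ks K ∧ K.phase ≠ 2 := by
    rintro ks K ⟨ks', hs, hp⟩
    exact ⟨⟨ks', hs, (List.prefix_append _ _).trans hp⟩, ⟨ks', hs, hp⟩,
      hphase ks' K hs (hp.subset (by simp))⟩
  induction h with
  | boolSchema J b => exact ⟨_, .boolSchema _ b⟩
  | objSchemaT _ ih =>
    obtain ⟨κ', h⟩ := ih hJ ⟨_, hX, List.prefix_rfl⟩
    exact ⟨_, .objSchemaT h⟩
  | objSchemaF _ ih =>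
    obtain ⟨κ', h⟩ := ih hJ ⟨_, hX, List.prefix_rfl⟩
    exact ⟨_, .objSchemaF h⟩
  | anyOf rs σ _ hr ih =>
    obtain ⟨l, ho⟩ := hX
    choose σ' h using fun i => ih i hJ (ho.isSub (List.getElem_mem i.2))
    exact ⟨_, .anyOf rs σ' h hr⟩
  | allOf rs σ _ hr ih =>
    obtain ⟨l, ho⟩ := hX
    choose σ' h using fun i => ih i hJ (ho.isSub (List.getElem_mem i.2))
    exact ⟨_, .allOf rs σ' h hr⟩
  | oneOf rs σ _ hr ih =>
    obtain ⟨l, ho⟩ := hX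
    choose σ' h using fun i => ih i hJ (ho.isSub (List.getElem_mem i.2))
    exact ⟨_, .oneOf rs σ' h hr⟩
  | not _ hr ih =>
    obtain ⟨l, ho⟩ := hX
    obtain ⟨κ', h⟩ := ih hJ (ho.isSub (by simp [Keyword.children]))
    exact ⟨_, .not h hr⟩
  | ref hu _ ih =>
    obtain ⟨κ', h⟩ := ih hJ hu.isSub
    exact ⟨_, .ref hu h⟩
  | @terminal J K r hK hr =>
    refine ⟨_, .terminal hK (hr.trans ?_)⟩
    subst hJ
    by_cases hc : ∃ Jc, K = .const Jc
    · obtain ⟨Jc, rfl⟩ := hc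
      obtain ⟨l, ho⟩ := hX
      have h₁ := (Prod.ext_iff.1 (hcode l _ ho)).1
      have hAp : ∀ A, Outcome D (Applies l (.const Jc)) N (mark A) true := fun A =>
        ⟨fun _ _ _ h => h.elim, by simp⟩
      simp only [code, hAp, true_and, eq_iff_iff, not_iff_not, Keyword.const.injEq] at h₁
      change inst N B A = Jc ↔ inst N B A' = Jc
      constructor
      · rintro rfl
        obtain ⟨B', h⟩ := h₁.1 ⟨B, rfl⟩
        exact inst_eq_of_const h
      · rintro rfl
        obtain ⟨B', h⟩ := h₁.2 ⟨B, rfl⟩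
        exact inst_eq_of_const h
    · exact cond_obj_iff fun Jc h => hc ⟨Jc, h⟩
  | trivial hi ht hn =>
    subst hJ
    exact ⟨_, .trivial hi ht fun h => hn ((htype _).2 h)⟩
  | propertyNames rs σ h hr _ =>
    injection hJ with h₁ h₂
    subst h₁
    exact ⟨_, .propertyNames rs σ h hr⟩
  | properties rs σ h hr _ =>
    injection hJ with h₁ h₂
    subst h₁
    rw [heq_eq_eq] at h₂
    subst h₂
    obtain ⟨l, ho⟩ := hX
    exact exists_judg_properties_iff.2 (hstruct l _ ho (by simp) _
      (exists_judg_properties_iff.1 ⟨_, .properties rs σ h hr⟩))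
  | patternProperties rs σ h hr _ =>
    injection hJ with h₁ h₂
    subst h₁
    rw [heq_eq_eq] at h₂
    subst h₂
    obtain ⟨l, ho⟩ := hX
    exact exists_judg_patternProperties_iff.2 (hstruct l _ ho (by simp) _
      (exists_judg_patternProperties_iff.1 ⟨_, .patternProperties rs σ h hr⟩))
  | prefixItems | contains | items | unevaluatedItems => cases hJ
  | nil J => exact ⟨_, .nil _⟩
  | independent hi _ _ hr ih₀ ih₁ =>
    obtain ⟨hl, ho, -⟩ := hprefix _ _ hX
    obtain ⟨κ₀, h₀⟩ := ih₀ hJ hl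
    obtain ⟨κ₁, h₁⟩ := ih₁ hJ ⟨_, ho⟩
    exact ⟨_, .independent hi h₀ h₁ hr⟩
  | trivialDependent hi ht hn _ ih =>
    obtain ⟨κ', h⟩ := ih hJ (hprefix _ _ hX).1
    subst hJ
    exact ⟨_, .trivialDependent hi ht (fun h => hn ((htype _).2 h)) h⟩
  | @additionalProperties names val ks S r₀ r κ rs σ _ h hr ih₀ _ =>
    obtain ⟨hl, ho, -⟩ := hprefix _ _ hX
    obtain ⟨κ₀, h₀⟩ := ih₀ hJ hl
    injection hJ with h₁ h₂
    subst h₁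
    rw [heq_eq_eq] at h₂
    subst h₂
    classical
    obtain ⟨rs', σ', h', hr'⟩ := outcome_additionalProperties_iff.1 (hstruct ks _ ho (by simp)
      (decide (∀ k : {k : String // k ∈ N ∪ B}, k.1 ∉ propsOf ks → rs k = true))
      (outcome_additionalProperties_iff.2 ⟨rs, σ, h, decide_eq_true_iff⟩))
    exact ⟨_, .additionalProperties rs' σ' h₀ h'
      (hr.trans (and_congr_right fun _ => decide_eq_true_iff.symm.trans hr'))⟩
  | unevaluatedProperties => exact absurd rfl (hprefix _ _ hX).2.2

/-- If a classical schema tells any two of the instances `inst N B A` with `A ⊆ N` apart, for some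
`B` that may depend on the two, then it has at least `#N / 2` keywords. -/
theorem card_le_two_mul_keywordCount {D : Schema} (hD : D.IsClassical) (N : Finset String)
    (h : ∀ A ⊆ N, ∀ A' ⊆ N, A ≠ A' →
      ∃ B, ¬ (D.Validates (inst N B A) ↔ D.Validates (inst N B A'))) :
    N.card ≤ 2 * D.keywordCount := by
  classical
  obtain ⟨L, hL, hlen⟩ := exists_list_occurs D
  let F : N.powerset → Fin L.length → Prop × Prop := fun A i =>
    code D N A (L.get i).1 (L.get i).2
  have hF : Function.Injective F := by
    rintro ⟨A, hA⟩ ⟨A', hA'⟩ hAA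
    rw [Finset.mem_powerset] at hA hA'
    by_contra hne
    obtain ⟨B, hB⟩ := h A hA A' hA' fun h => hne (Subtype.ext h)
    have hcode : ∀ l K, Occurs D l K → code D N A l K = code D N A' l K := fun l K ho => by
      obtain ⟨i, hi⟩ := List.get_of_mem (hL (l, K) ho)
      simpa only [F, hi] using congrFun hAA i
    exact hB ⟨fun ⟨κ, hκ⟩ => hκ.transfer hD.2 hA hA' hcode rfl .refl,
      fun ⟨κ, hκ⟩ => hκ.transfer hD.2 hA' hA (fun l K ho => (hcode l K ho).symm) rfl .refl⟩
  have hcard := Fintype.card_le_of_injective F hF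
  rw [Fintype.card_coe, Finset.card_powerset, Fintype.card_fun, Fintype.card_prod,
    Fintype.card_prop, Fintype.card_fin, ← pow_two, ← pow_mul] at hcard
  exact ((Nat.pow_le_pow_iff_right (by norm_num)).1 hcard).trans (by omega)

/-! ### Schemas without references -/

theorem Schema.count_obj_eq_zero {P : Keyword → Prop} {ks : List Keyword}
    (h : ∀ K ∈ ks, ¬ P K ∧ ∀ C ∈ K.children, C.count P = 0) : (Schema.obj ks).count P = 0 := by
  rw [Schema.count, Schema.total_obj, zero_add, List.sum_eq_zero]
  intro x hx
  obtain ⟨K, hK, rfl⟩ := List.mem_map.1 hx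
  rw [if_neg (h K hK).1, zero_add, List.sum_eq_zero]
  intro x hx
  obtain ⟨C, hC, rfl⟩ := List.mem_map.1 hx
  exact (h K hK).2 C hC

@[simp]
theorem Schema.count_bool {P : Keyword → Prop} {b : Bool} : (Schema.bool b).count P = 0 :=
  Schema.total_bool _ _ _

/-- Well-formed schemas without references and anchors, for which well-formedness is a local
property of each list of adjacent keywords. -/
inductive RefFree : Schema → Prop
  | bool (b : Bool) : RefFree (.bool b)
  | obj {ks : List Keyword} :
      (ks.Pairwise fun K K' => K.phase ≤ K'.phase ∧ ¬ K.SameName K') →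
      (∀ K ∈ ks, K.ArgOk ∧ (∀ u, K ≠ .ref u) ∧ ∀ aa, K ≠ .anchor aa) →
      (∀ K ∈ ks, ∀ C ∈ K.children, RefFree C) → RefFree (.obj ks)

theorem RefFree.of_isSub {D S : Schema} (hD : RefFree D) (h : D.IsSub S) : RefFree S := by
  induction h with
  | refl => exact hD
  | step _ hK hC ih =>
    cases ih with
    | obj _ _ h => exact h _ hK _ hC

theorem RefFree.isStaticModern {D : Schema} (hD : RefFree D) : D.IsStaticModern where
  ordered ks h := by
    cases hD.of_isSub h with
    | obj h _ _ => exact h.imp fun h => h.1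
  distinct ks h := by
    cases hD.of_isSub h with
    | obj h _ _ => exact h.imp fun h => h.2
  args ks h K hK := by
    cases hD.of_isSub h with
    | obj _ h _ => exact (h K hK).1
  anchors aa := by
    refine le_of_eq_of_le ?_ zero_le_one
    induction hD with
    | bool b => simp
    | obj _ h _ ih =>
      exact Schema.count_obj_eq_zero fun K hK => ⟨(h K hK).2.2 aa, fun C hC => ih K hK C hC⟩
  closed ks h u hu := by
    cases hD.of_isSub h with
    | obj _ h _ => exact absurd rfl ((h _ hu).2.1 u)
  guarded := by
    -- Without references, a schema only depends on smaller ones.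
    have hstep : ∀ {S S'}, RefFree S → DependsOn D S S' → RefFree S' ∧ sizeOf S' < sizeOf S := by
      rintro S S' hS ⟨ks, rfl, K, hK, ⟨-, hC⟩ | ⟨u, rfl, -⟩⟩
      · cases hS with
        | obj _ _ h =>
          have h1 := Keyword.sizeOf_children hC
          have h2 := List.sizeOf_lt_of_mem hK
          refine ⟨h K hK _ hC, ?_⟩
          simp only [Schema.obj.sizeOf_spec]
          omega
      · cases hS with
        | obj _ h _ => exact absurd rfl ((h _ hK).2.1 u)
    intro S hS h
    have : ∀ {S'}, Relation.TransGen (DependsOn D) S S' →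
        RefFree S' ∧ sizeOf S' < sizeOf S := by
      intro S' h
      induction h with
      | single h => exact hstep (hD.of_isSub hS) h
      | tail _ h ih =>
        have := hstep ih.1 h
        exact ⟨this.1, this.2.trans ih.2⟩
    exact lt_irrefl _ (this h).2

/-! ### Unique results of validation -/

/-- Validation of `J` by `X` returns `r` and `κ`, and nothing else. -/
def Returns (D : Schema) (J : JVal) (X : Subject) (r : Bool) (κ : Annot) : Prop :=
  Judg D J X r κ ∧ ∀ r' κ', Judg D J X r' κ' → r' = r ∧ κ' = κ

variable {D : Schema} {J : JVal}

theorem Returns.validates_iff {S : Schema} {r : Bool} {κ : Annot}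
    (h : Returns S J (.schema S) r κ) : S.Validates J ↔ r = true :=
  ⟨fun ⟨_, h'⟩ => (h.2 _ _ h').1.symm, fun hr => ⟨κ, hr ▸ h.1⟩⟩

theorem Returns.unique {X : Subject} {r r' : Bool} {κ κ' : Annot} (h : Returns D J X r κ)
    (h' : Returns D J X r' κ') : r = r' ∧ κ = κ' :=
  h'.2 _ _ h.1

theorem returns_bool (b : Bool) : Returns D J (.schema (.bool b)) b ∅ :=
  ⟨.boolSchema J b, fun r' κ' h => by cases h; exact ⟨rfl, rfl⟩⟩

theorem Returns.obj {ks : List Keyword} {r : Bool} {κ : Annot} (h : Returns D J (.list ks) r κ) :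
    Returns D J (.schema (.obj ks)) r (if r then κ else ∅) := by
  refine ⟨?_, fun r' κ' h' => ?_⟩
  · cases r with
    | true => exact .objSchemaT h.1
    | false => exact .objSchemaF h.1
  · cases h' with
    | objSchemaT h' => obtain ⟨rfl, rfl⟩ := h.2 _ _ h'; exact ⟨rfl, rfl⟩
    | objSchemaF h' => obtain ⟨rfl, rfl⟩ := h.2 _ _ h'; exact ⟨rfl, rfl⟩

theorem returns_terminal {r : Bool} (K : Keyword) (hr : r = true ↔ K.Cond J)
    (hK : K.IsTerminal := by exact True.intro) :
    Returns D J (.keyword K) r ∅ := by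
  refine ⟨.terminal hK hr, fun r' κ' h => ?_⟩
  cases h with
  | terminal _ hr' => exact ⟨Bool.eq_iff_iff.2 (hr'.trans hr.symm), rfl⟩
  | trivial _ ht => cases K <;> first | exact hK.elim | cases ht
  | _ => exact hK.elim

theorem returns_trivial {t : Tp} (K : Keyword) (hJ : ¬ J.HasType t)
    (hK : K.IsIndependent := by exact rfl) (ht : K.target = some t := by exact rfl) :
    Returns D J (.keyword K) true ∅ := by
  refine ⟨.trivial hK ht hJ, fun r' κ' h => ?_⟩
  cases h with
  | terminal h => cases K <;> first | exact h.elim | cases ht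
  | trivial => exact ⟨rfl, rfl⟩
  | propertyNames | properties | patternProperties | prefixItems | contains =>
    cases ht; exact absurd True.intro hJ
  | _ => cases ht

theorem returns_anyOf {Ss : List Schema} {r : Bool} {rs : Fin Ss.length → Bool}
    {σ : Fin Ss.length → Annot} (h : ∀ i, Returns D J (.schema Ss[i]) (rs i) (σ i))
    (hr : r = true ↔ ∃ i, rs i = true) : Returns D J (.keyword (.anyOf Ss)) r (⋃ i, σ i) := by
  refine ⟨.anyOf rs σ (fun i => (h i).1) hr, fun r' κ' h' => ?_⟩
  cases h' with
  | anyOf rs' σ' h' hr' =>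
    obtain rfl : rs' = rs := funext fun i => ((h i).2 _ _ (h' i)).1
    obtain rfl : σ' = σ := funext fun i => ((h i).2 _ _ (h' i)).2
    exact ⟨Bool.eq_iff_iff.2 (hr'.trans hr.symm), rfl⟩
  | terminal h => exact h.elim
  | trivial _ h => cases h

theorem returns_patternProperties_true {names : Finset String}
    {val : {k : String // k ∈ names} → JVal} {ps : List (Pattern × Schema)}
    (hps : ∀ p ∈ ps, p.2 = .bool true) :
    Returns D (.obj names val) (.keyword (.patternProperties ps)) true
      {a | ∃ k ∈ names, a = .inl k ∧ ∃ j : Fin ps.length, k ∈ ps[j].1.lang} := by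
  have hj : ∀ j : Fin ps.length, ps[j].2 = .bool true := fun j => hps _ (List.getElem_mem j.2)
  refine ⟨.patternProperties (fun _ _ => true) (fun _ _ => ∅) (fun k j _ => ?_) (by simp),
    fun r' κ' h => ?_⟩
  · rw [hj]; exact .boolSchema _ _
  · cases h with
    | patternProperties rs σ h hr =>
      refine ⟨hr.2 fun k j hk => ?_, rfl⟩
      have := h k j hk
      rw [hj] at this
      exact ((returns_bool true).2 _ _ this).1
    | terminal h => exact h.elim
    | trivial _ h h' => cases h; exact absurd True.intro h'

theorem returns_nil : Returns D J (.list []) true ∅ := by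
  refine ⟨.nil J, fun r' κ' h => ?_⟩
  generalize hX : Subject.list [] = X at h
  cases h with
  | nil => exact ⟨rfl, rfl⟩
  | independent | trivialDependent | additionalProperties | unevaluatedProperties | items
  | unevaluatedItems => simp at hX
  | _ => cases hX

theorem snoc_inj {ks ks' : List Keyword} {K K' : Keyword}
    (h : Subject.list (ks ++ [K]) = Subject.list (ks' ++ [K'])) : ks = ks' ∧ K = K' := by
  obtain ⟨h₁, h₂⟩ := List.append_inj' (Subject.list.inj h) rfl
  exact ⟨h₁, List.singleton_inj.1 h₂⟩

theorem Returns.snoc {ks : List Keyword} {K : Keyword} {r₀ r₁ : Bool} {κ₀ κ₁ : Annot}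
    (h₀ : Returns D J (.list ks) r₀ κ₀)
    (h₁ : Returns D J (.keyword K) r₁ κ₁) (hK : K.IsIndependent := by exact rfl) :
    Returns D J (.list (ks ++ [K])) (r₀ && r₁) (κ₀ ∪ κ₁) := by
  refine ⟨.independent hK h₀.1 h₁.1 rfl, fun r' κ' h => ?_⟩
  generalize hX : Subject.list (ks ++ [K]) = X at h
  cases h with
  | nil => simp at hX
  | independent hK' h₀' h₁' hr =>
    obtain ⟨rfl, ⟨⟩⟩ := snoc_inj hX
    obtain ⟨rfl, rfl⟩ := h₀.2 _ _ h₀'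
    obtain ⟨rfl, rfl⟩ := h₁.2 _ _ h₁'
    exact ⟨hr, rfl⟩
  | trivialDependent hK' =>
    obtain ⟨rfl, ⟨⟩⟩ := snoc_inj hX
    exact absurd hK hK'
  | additionalProperties | unevaluatedProperties | items | unevaluatedItems =>
    obtain ⟨rfl, ⟨⟩⟩ := snoc_inj hX
    cases hK
  | _ => cases hX

theorem Returns.snoc_trivial {ks : List Keyword} {K : Keyword} {t : Tp} {r : Bool} {κ : Annot}
    (h₀ : Returns D J (.list ks) r κ) (hJ : ¬ J.HasType t) (hK : ¬ K.IsIndependent)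
    (ht : K.target = some t := by exact rfl) : Returns D J (.list (ks ++ [K])) r κ := by
  refine ⟨.trivialDependent hK ht hJ h₀.1, fun r' κ' h => ?_⟩
  generalize hX : Subject.list (ks ++ [K]) = X at h
  cases h with
  | nil => simp at hX
  | independent hK' =>
    obtain ⟨rfl, ⟨⟩⟩ := snoc_inj hX
    exact absurd hK' hK
  | trivialDependent _ _ _ h₀' =>
    obtain ⟨rfl, ⟨⟩⟩ := snoc_inj hX
    exact h₀.2 _ _ h₀'
  | additionalProperties | unevaluatedProperties | items | unevaluatedItems =>
    obtain ⟨rfl, ⟨⟩⟩ := snoc_inj hX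
    cases ht
    exact absurd True.intro hJ
  | _ => cases hX

theorem Returns.snoc_additionalProperties {names : Finset String}
    {val : {k : String // k ∈ names} → JVal} {ks : List Keyword} {S : Schema} {r₀ r : Bool}
    {κ : Annot} {rs : {k : String // k ∈ names} → Bool} {σ : {k : String // k ∈ names} → Annot}
    (h₀ : Returns D (.obj names val) (.list ks) r₀ κ)
    (h : ∀ k, Returns D (val k) (.schema S) (rs k) (σ k))
    (hr : r = true ↔ r₀ = true ∧ ∀ k, k.1 ∉ propsOf ks → rs k = true) :
    Returns D (.obj names val) (.list (ks ++ [.additionalProperties S])) r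
      (JVal.obj names val).all := by
  refine ⟨.additionalProperties rs σ h₀.1 (fun k _ => (h k).1) hr, fun r' κ' h' => ?_⟩
  generalize hX : Subject.list (ks ++ [.additionalProperties S]) = X at h'
  cases h' with
  | nil => simp at hX
  | independent hK' =>
    obtain ⟨rfl, ⟨⟩⟩ := snoc_inj hX
    cases hK'
  | trivialDependent _ ht hJ =>
    obtain ⟨rfl, ⟨⟩⟩ := snoc_inj hX
    cases ht
    exact absurd True.intro hJ
  | additionalProperties rs' σ' h₀' h' hr' =>
    obtain ⟨rfl, ⟨⟩⟩ := snoc_inj hX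
    obtain ⟨rfl, rfl⟩ := h₀.2 _ _ h₀'
    refine ⟨Bool.eq_iff_iff.2 (hr'.trans (Iff.trans (and_congr_right fun _ => ?_) hr.symm)), rfl⟩
    exact forall₂_congr fun k hk => by rw [((h k).2 _ _ (h' k hk)).1]
  | unevaluatedProperties =>
    obtain ⟨rfl, ⟨⟩⟩ := snoc_inj hX
  | _ => cases hX

theorem Returns.snoc_unevaluatedProperties {names : Finset String}
    {val : {k : String // k ∈ names} → JVal} {ks : List Keyword} {S : Schema} {r₀ r : Bool}
    {κ : Annot} {rs : {k : String // k ∈ names} → Bool} {σ : {k : String // k ∈ names} → Annot}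
    (h₀ : Returns D (.obj names val) (.list ks) r₀ κ)
    (h : ∀ k, Returns D (val k) (.schema S) (rs k) (σ k))
    (hr : r = true ↔ r₀ = true ∧ ∀ k, .inl k.1 ∉ κ → rs k = true) :
    Returns D (.obj names val) (.list (ks ++ [.unevaluatedProperties S])) r
      (JVal.obj names val).all := by
  refine ⟨.unevaluatedProperties rs σ h₀.1 (fun k _ => (h k).1) hr, fun r' κ' h' => ?_⟩
  generalize hX : Subject.list (ks ++ [.unevaluatedProperties S]) = X at h'
  cases h' with
  | nil => simp at hX
  | independent hK' =>
    obtain ⟨rfl, ⟨⟩⟩ := snoc_inj hX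
    cases hK'
  | trivialDependent _ ht hJ =>
    obtain ⟨rfl, ⟨⟩⟩ := snoc_inj hX
    cases ht
    exact absurd True.intro hJ
  | unevaluatedProperties rs' σ' h₀' h' hr' =>
    obtain ⟨rfl, ⟨⟩⟩ := snoc_inj hX
    obtain ⟨rfl, rfl⟩ := h₀.2 _ _ h₀'
    refine ⟨Bool.eq_iff_iff.2 (hr'.trans (Iff.trans (and_congr_right fun _ => ?_) hr.symm)), rfl⟩
    exact forall₂_congr fun k hk => by rw [((h k).2 _ _ (h' k hk)).1]
  | additionalProperties =>
    obtain ⟨rfl, ⟨⟩⟩ := snoc_inj hX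
  | _ => cases hX

/-! ### Positions of binary words, their patterns and their flags -/

/-- The binary digits, as characters. -/
def bitChar (c : Bool) : Char := Nat.digitChar c.toNat

theorem bitChar_injective : Function.Injective bitChar := by
  decide

/-- For `x = (i, c)`, the pattern `^.{i}c`: the character at position `i` is the digit `c`. -/
def bitPattern (x : ℕ × Bool) : Pattern :=
  .cat .bos (.cat (.rep .any x.1 (some x.1)) (.char (bitChar x.2)))

theorem bitPattern_injective : Function.Injective bitPattern := by
  rintro ⟨i, c⟩ ⟨i', c'⟩ h
  simp only [bitPattern, Pattern.cat.injEq, Pattern.rep.injEq, Pattern.char.injEq, true_and] at h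
  rw [h.1.1, bitChar_injective h.2]

theorem mem_lang_bitPattern {x : ℕ × Bool} {s : String} :
    s ∈ (bitPattern x).lang ↔ s.toList[x.1]? = some (bitChar x.2) := by
  simp only [Pattern.lang, bitPattern, Pattern.MatchAt, Set.mem_ofPred_eq]
  constructor
  · rintro ⟨_, _, -, _, ⟨rfl, rfl⟩, m, ⟨c, f, h₁, h₂, h₃, rfl, h₄⟩, -, h⟩
    obtain rfl : c = x.1 := le_antisymm (h₂ _ rfl) h₁
    -- The repetition advances by one character in each of its steps.
    have hf : ∀ t ≤ x.1, f t = t := by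
      intro t
      induction t with
      | zero => exact fun _ => h₃
      | succ t ih => exact fun ht => by rw [(h₄ t ht).1, ih (by omega)]
    rwa [hf _ le_rfl] at h
  · intro h
    have hlt : x.1 < s.toList.length := (List.getElem?_eq_some_iff.1 h).1
    refine ⟨0, x.1 + 1, Nat.zero_le _, 0, ⟨rfl, rfl⟩, x.1, ⟨x.1, id, le_rfl, ?_, rfl, rfl, ?_⟩,
      rfl, h⟩
    · rintro _ ⟨⟩
      exact le_rfl
    · exact fun t ht => ⟨rfl, ht.trans hlt⟩

/-- The name of the flag of a position and a digit: the letter x, followed by a decimal number. -/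
def flag (x : ℕ × Bool) : String :=
  .ofList (Char.ofNat 120 :: Nat.toDigits 10 (2 * x.1 + x.2.toNat))

theorem flag_injective : Function.Injective flag := by
  rintro ⟨i, c⟩ ⟨i', c'⟩ h
  have h₁ := (List.cons.inj (String.ofList_injective h)).2
  have h₂ := congrArg (fun l => Nat.ofDigitChars 10 l 0) h₁
  simp only [Nat.ofDigitChars_ten_toDigits] at h₂
  cases c <;> cases c' <;> simp at h₂ ⊢ <;> omega

/-- All positions of words of length `n`, with both binary digits. -/
def indices (n : ℕ) : List (ℕ × Bool) := (List.range n).product [false, true]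

theorem mem_indices {n : ℕ} {x : ℕ × Bool} : x ∈ indices n ↔ x.1 < n := by
  obtain ⟨i, c⟩ := x
  cases c <;> simp [indices]

theorem length_indices (n : ℕ) : (indices n).length = n * 2 := by
  exact (List.length_product _ _).trans (by simp)

theorem nodup_indices (n : ℕ) : (indices n).Nodup :=
  List.nodup_range.product (by simp)

/-! ### The schemas -/

/-- The schema of `null`. -/
def nullSchema : Schema := .obj [.type .null]

/-- If the flag of `x` is present, then the fields that match the pattern of `x` are evaluated. -/
def branch (x : ℕ × Bool) : Schema :=
  .obj [.required [flag x], .patternProperties [(bitPattern x, .bool true)]]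

/-- All fields have the value `null`, except for those that match the pattern of some `x` with a
flag that is present. The first branch of `anyOf` makes this keyword true in any case. -/
def modernSchema (n : ℕ) : Schema :=
  .obj [.anyOf (.bool true :: (indices n).map branch), .unevaluatedProperties nullSchema]

/-- All flags of the elements of `U` are present, and all fields have the value `null`, except for
those that match the pattern of some element of `U`. -/
def selection (U : List (ℕ × Bool)) : Schema :=
  .obj [.required (U.map flag), .patternProperties (U.map fun x => (bitPattern x, .bool true)),
    .additionalProperties nullSchema]

/-- The classical schema that guesses the set of flags. -/
def classicalSchema (n : ℕ) : Schema :=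
  .obj [.anyOf ((indices n).sublists.map selection)]

theorem refFree_nullSchema : RefFree nullSchema := by
  refine .obj (by simp) (by simp [Keyword.ArgOk]) (by simp [Keyword.children])

theorem refFree_branch (x : ℕ × Bool) : RefFree (branch x) := by
  refine .obj ?_ (by simp [Keyword.ArgOk]) ?_
  · simp [Keyword.phase, Keyword.SameName, Keyword.ctorIdx]
  · simpa [Keyword.children] using RefFree.bool true

theorem refFree_modernSchema (n : ℕ) : RefFree (modernSchema n) := by
  refine .obj ?_ (by simp [Keyword.ArgOk]) ?_
  · simp [Keyword.phase, Keyword.SameName, Keyword.ctorIdx]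
  · intro K hK C hC
    simp only [List.mem_cons, List.not_mem_nil, or_false] at hK
    rcases hK with rfl | rfl
    · simp only [Keyword.children, List.mem_cons, List.mem_map] at hC
      rcases hC with rfl | ⟨x, -, rfl⟩
      exacts [.bool true, refFree_branch x]
    · simp only [Keyword.children, List.mem_singleton] at hC
      exact hC ▸ refFree_nullSchema

theorem refFree_selection {U : List (ℕ × Bool)} (hU : U.Nodup) : RefFree (selection U) := by
  refine .obj ?_ ?_ ?_
  · simp [Keyword.phase, Keyword.SameName, Keyword.ctorIdx]
  · have : ((U.map fun x => (bitPattern x, Schema.bool true)).map Prod.fst).Nodup := by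
      rw [List.map_map]
      exact hU.map bitPattern_injective
    simpa [Keyword.ArgOk] using this
  · intro K hK C hC
    simp only [List.mem_cons, List.not_mem_nil, or_false] at hK
    rcases hK with rfl | rfl | rfl
    · cases hC
    · simp only [Keyword.children, List.map_map, List.mem_map] at hC
      obtain ⟨x, -, rfl⟩ := hC
      exact .bool true
    · simp only [Keyword.children, List.mem_singleton] at hC
      exact hC ▸ refFree_nullSchema

theorem refFree_classicalSchema (n : ℕ) : RefFree (classicalSchema n) := by
  refine .obj (by simp) (by simp [Keyword.ArgOk]) ?_
  intro K hK C hC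
  rw [List.mem_singleton] at hK
  subst hK
  simp only [Keyword.children, List.mem_map, List.mem_sublists] at hC
  obtain ⟨U, hU, rfl⟩ := hC
  exact refFree_selection ((nodup_indices n).sublist hU)

theorem count_nullSchema {P : Keyword → Prop} (h : ¬ P (.type .null)) :
    nullSchema.count P = 0 :=
  Schema.count_obj_eq_zero (by simp [h, Keyword.children])

theorem count_modernSchema {P : Keyword → Prop} (n : ℕ)
    (hP : P (.unevaluatedProperties nullSchema)) (hP' : ∀ K, P K → K.phase = 2) :
    (modernSchema n).count P = 1 := by
  have h₀ : ∀ K : Keyword, K.phase ≠ 2 → ¬ P K := fun K hK h => hK (hP' K h)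
  have hb : ∀ x, (branch x).count P = 0 := fun x =>
    Schema.count_obj_eq_zero (by
      simp [h₀ (.required _) (by simp [Keyword.phase]),
        h₀ (.patternProperties _) (by simp [Keyword.phase]), Keyword.children])
  have ht := count_nullSchema (h₀ (.type .null) (by simp [Keyword.phase]))
  have ha := h₀ (.anyOf (.bool true :: (indices n).map branch)) (by simp [Keyword.phase])
  unfold Schema.count at hb ht ⊢
  rw [modernSchema, Schema.total_obj]
  simp [ha, hP, Keyword.children, hb, ht, Function.comp_def, Schema.total_bool]

theorem count_phase_classicalSchema (n : ℕ) :
    (classicalSchema n).count (fun K => K.phase = 2) = 0 := by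
  refine Schema.count_obj_eq_zero ?_
  simp only [List.mem_singleton, forall_eq, Keyword.phase, Keyword.children, List.mem_map]
  refine ⟨by simp, ?_⟩
  rintro _ ⟨U, -, rfl⟩
  refine Schema.count_obj_eq_zero ?_
  simp [Keyword.children, count_nullSchema]

theorem isClassical_classicalSchema (n : ℕ) : (classicalSchema n).IsClassical :=
  ⟨(refFree_classicalSchema n).isStaticModern, count_phase_classicalSchema n⟩

/-! ### The meaning of the schemas -/

/-- Unlike in `returns_anyOf`, the result and the annotation are described without an enumeration
of the results of the branches. -/
theorem exists_returns_anyOf {Ss : List Schema}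
    (h : ∀ S ∈ Ss, ∃ r κ, Returns D J (.schema S) r κ) :
    ∃ r κ, Returns D J (.keyword (.anyOf Ss)) r κ ∧
      (r = true ↔ ∃ S ∈ Ss, ∃ κ', Returns D J (.schema S) true κ') ∧
      ∀ a, a ∈ κ ↔ ∃ S ∈ Ss, ∃ r' κ', Returns D J (.schema S) r' κ' ∧ a ∈ κ' := by
  classical
  choose rs σ h using fun i : Fin Ss.length => h Ss[i] (List.getElem_mem i.2)
  refine ⟨decide (∃ i, rs i = true), _, returns_anyOf h decide_eq_true_iff, ?_, fun a => ?_⟩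
  · rw [decide_eq_true_iff]
    constructor
    · rintro ⟨i, hi⟩
      exact ⟨Ss[i], List.getElem_mem i.2, σ i, hi ▸ h i⟩
    · rintro ⟨S, hS, κ', h'⟩
      obtain ⟨i, hi, rfl⟩ := List.getElem_of_mem hS
      exact ⟨⟨i, hi⟩, ((h ⟨i, hi⟩).unique h').1⟩
  · rw [Set.mem_iUnion]
    constructor
    · rintro ⟨i, hi⟩
      exact ⟨Ss[i], List.getElem_mem i.2, rs i, σ i, h i, hi⟩
    · rintro ⟨S, hS, r', κ', h', ha⟩
      obtain ⟨i, hi, rfl⟩ := List.getElem_of_mem hS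
      exact ⟨⟨i, hi⟩, ((h ⟨i, hi⟩).unique h').2 ▸ ha⟩

open Classical in
theorem returns_nullSchema :
    ∃ κ, Returns D J (.schema nullSchema) (decide (J = .null)) κ := by
  have h := ((returns_nil (D := D) (J := J)).snoc
    (returns_terminal (r := decide (J = .null)) (.type .null) (by
      rw [decide_eq_true_iff]
      change _ ↔ J.HasType .null
      cases J <;> simp [JVal.HasType]))).obj
  rw [Bool.true_and] at h
  exact ⟨_, h⟩

open Classical in
theorem returns_required {names : Finset String} {val : {k : String // k ∈ names} → JVal}
    {ks : List String} : Returns D (.obj names val) (.keyword (.required ks))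
      (decide (∀ k ∈ ks, k ∈ names)) ∅ :=
  returns_terminal _ decide_eq_true_iff

open Classical in
theorem returns_branch {names : Finset String} {val : {k : String // k ∈ names} → JVal}
    (x : ℕ × Bool) : Returns D (.obj names val) (.schema (branch x)) (decide (flag x ∈ names))
      {a | flag x ∈ names ∧ ∃ k ∈ names, a = .inl k ∧ k ∈ (bitPattern x).lang} := by
  have h := (((returns_nil (D := D) (J := .obj names val)).snoc
    (returns_required (ks := [flag x]))).snoc
      (returns_patternProperties_true (ps := [(bitPattern x, .bool true)]) (by simp))).obj
  convert h using 1
  · rfl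
  · simp
  · by_cases hx : flag x ∈ names <;> simp [hx]

/-- The fields of an object that have to be `null` are `null`. -/
def Good (n : ℕ) (names : Finset String) (val : {k : String // k ∈ names} → JVal) : Prop :=
  ∀ k, val k = .null ∨ ∃ x ∈ indices n, flag x ∈ names ∧ k.1 ∈ (bitPattern x).lang

theorem validates_modernSchema_obj {n : ℕ} {names : Finset String}
    {val : {k : String // k ∈ names} → JVal} :
    (modernSchema n).Validates (.obj names val) ↔ Good n names val := by
  classical
  obtain ⟨r, κ, h, hr, hκ⟩ := exists_returns_anyOf (D := modernSchema n) (J := .obj names val)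
    (Ss := .bool true :: (indices n).map branch) (by
      intro S hS
      simp only [List.mem_cons, List.mem_map] at hS
      rcases hS with rfl | ⟨x, -, rfl⟩
      exacts [⟨_, _, returns_bool true⟩, ⟨_, _, returns_branch x⟩])
  obtain rfl : r = true := hr.2 ⟨_, List.mem_cons_self, _, returns_bool true⟩
  have hκ' : ∀ k ∈ names, Sum.inl k ∈ κ ↔
      ∃ x ∈ indices n, flag x ∈ names ∧ k ∈ (bitPattern x).lang := by
    intro k hk
    rw [hκ]
    constructor
    · rintro ⟨S, hS, r', κ', h', ha⟩
      simp only [List.mem_cons, List.mem_map] at hS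
      rcases hS with rfl | ⟨x, hx, rfl⟩
      · rw [(h'.unique (returns_bool true)).2] at ha
        exact ha.elim
      · rw [(h'.unique (returns_branch x)).2] at ha
        obtain ⟨hf, k', -, hkk, hl⟩ := ha
        cases hkk
        exact ⟨x, hx, hf, hl⟩
    · rintro ⟨x, hx, hf, hl⟩
      exact ⟨_, List.mem_cons_of_mem _ (List.mem_map_of_mem hx), _, _, returns_branch x,
        hf, k, hk, rfl, hl⟩
  choose σ hσ using fun k => returns_nullSchema (D := modernSchema n) (J := val k)
  have := ((returns_nil.snoc h).snoc_unevaluatedProperties hσ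
    (r := decide (Good n names val)) ?_).obj
  · rw [Returns.validates_iff this, decide_eq_true_iff]
  · rw [decide_eq_true_iff]
    simp only [decide_eq_true_iff, Good, Bool.and_self, true_and, Set.empty_union]
    refine forall_congr' fun k => ?_
    rw [hκ' _ k.2, or_comm, or_iff_not_imp_left]

theorem validates_modernSchema_of_not_obj {n : ℕ} (hJ : ¬ J.HasType .object) :
    (modernSchema n).Validates J := by
  obtain ⟨r, κ, h, hr, -⟩ := exists_returns_anyOf (D := modernSchema n) (J := J)
    (Ss := .bool true :: (indices n).map branch) (by
      intro S hS
      simp only [List.mem_cons, List.mem_map] at hS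
      rcases hS with rfl | ⟨x, -, rfl⟩
      · exact ⟨_, _, returns_bool true⟩
      · refine ⟨_, _, ((returns_nil.snoc
          (returns_terminal (r := true) (.required [flag x]) ?_)).snoc
          (returns_trivial (.patternProperties [(bitPattern x, .bool true)]) hJ)).obj⟩
        cases J <;> simp [Keyword.Cond, JVal.HasType] at hJ ⊢)
  obtain rfl : r = true := hr.2 ⟨_, List.mem_cons_self, _, returns_bool true⟩
  have := ((returns_nil.snoc h).snoc_trivial (K := .unevaluatedProperties nullSchema)
    hJ (by simp [Keyword.IsIndependent, Keyword.phase])).obj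
  exact this.validates_iff.2 rfl

open Classical in
theorem returns_selection {names : Finset String} {val : {k : String // k ∈ names} → JVal}
    (U : List (ℕ × Bool)) : ∃ κ, Returns D (.obj names val) (.schema (selection U))
      (decide ((∀ x ∈ U, flag x ∈ names) ∧
        ∀ k, val k = .null ∨ ∃ x ∈ U, k.1 ∈ (bitPattern x).lang)) κ := by
  choose σ hσ using fun k => returns_nullSchema (D := D) (J := val k)
  have h := ((((returns_nil (D := D) (J := .obj names val)).snoc
    (returns_required (ks := U.map flag))).snoc (returns_patternProperties_true
      (ps := U.map fun x => (bitPattern x, .bool true))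
        (by rw [List.forall_mem_map]; simp))).snoc_additionalProperties hσ
        (r := decide ((∀ x ∈ U, flag x ∈ names) ∧
          ∀ k, val k = .null ∨ ∃ x ∈ U, k.1 ∈ (bitPattern x).lang)) ?_).obj
  · exact ⟨_, h⟩
  · simp only [decide_eq_true_iff, Bool.true_and, Bool.and_true, List.forall_mem_map]
    refine and_congr_right fun _ => forall_congr' fun k => ?_
    have : k.1 ∈ propsOf [.required (U.map flag),
        .patternProperties (U.map fun x => (bitPattern x, .bool true))] ↔
          ∃ x ∈ U, k.1 ∈ (bitPattern x).lang := by
      simp [propsOf, -Prod.exists]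
    change _ ↔ (k.1 ∉ propsOf [.required (U.map flag),
        .patternProperties (U.map fun x => (bitPattern x, .bool true))] → _)
    rw [this, or_comm, or_iff_not_imp_left]

theorem validates_classicalSchema_obj {n : ℕ} {names : Finset String}
    {val : {k : String // k ∈ names} → JVal} :
    (classicalSchema n).Validates (.obj names val) ↔ Good n names val := by
  classical
  obtain ⟨r, κ, h, hr, -⟩ := exists_returns_anyOf (D := classicalSchema n)
    (J := .obj names val) (Ss := (indices n).sublists.map selection) (by
      intro S hS
      obtain ⟨U, -, rfl⟩ := List.mem_map.1 hS
      exact ⟨_, returns_selection U⟩)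
  have := (returns_nil.snoc h).obj
  rw [Bool.true_and] at this
  rw [Returns.validates_iff this, hr]
  constructor
  · rintro ⟨S, hS, κ', h'⟩ k
    obtain ⟨U, hU, rfl⟩ := List.mem_map.1 hS
    obtain ⟨κ'', h''⟩ := returns_selection (D := classicalSchema n) (val := val) U
    obtain ⟨hf, hk⟩ := decide_eq_true_iff.1 (h''.unique h').1
    refine (hk k).imp_right ?_
    rintro ⟨x, hx, hl⟩
    exact ⟨x, (List.mem_sublists.1 hU).subset hx, hf x hx, hl⟩
  · -- The list of all flags that are present is the best guess.
    intro hg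
    refine ⟨selection ((indices n).filter fun x => flag x ∈ names),
      List.mem_map_of_mem (List.mem_sublists.2 List.filter_sublist), ?_⟩
    obtain ⟨κ'', h''⟩ := returns_selection (D := classicalSchema n) (val := val)
      ((indices n).filter fun x => flag x ∈ names)
    refine ⟨κ'', ?_⟩
    convert h'' using 1
    rw [eq_comm, decide_eq_true_iff]
    refine ⟨by simp, fun k => (hg k).imp_right ?_⟩
    rintro ⟨x, hx, hf, hl⟩
    exact ⟨x, by simp [hx, hf], hl⟩

theorem validates_classicalSchema_of_not_obj {n : ℕ} (hJ : ¬ J.HasType .object) :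
    (classicalSchema n).Validates J := by
  have hsel : ∀ U, ∃ κ, Returns (classicalSchema n) J (.schema (selection U)) true κ := fun U =>
    ⟨_, ((((returns_nil.snoc (returns_terminal (r := true) (.required (U.map flag)) (by
      cases J <;> simp [Keyword.Cond, JVal.HasType] at hJ ⊢))).snoc
      (returns_trivial (.patternProperties (U.map fun x => (bitPattern x, .bool true)))
        hJ)).snoc_trivial (K := .additionalProperties nullSchema) hJ
          (by simp [Keyword.IsIndependent, Keyword.phase]))).obj⟩
  obtain ⟨r, κ, h, hr, -⟩ := exists_returns_anyOf (D := classicalSchema n) (J := J)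
    (Ss := (indices n).sublists.map selection) (by
      intro S hS
      obtain ⟨U, -, rfl⟩ := List.mem_map.1 hS
      exact ⟨_, hsel U⟩)
  obtain rfl : r = true :=
    hr.2 ⟨_, List.mem_map_of_mem (List.mem_sublists.2 (List.nil_sublist _)), hsel []⟩
  exact (returns_nil.snoc h).obj.validates_iff.2 rfl

theorem equivalent_classicalSchema_modernSchema (n : ℕ) :
    (classicalSchema n).Equivalent (modernSchema n) := by
  intro J
  by_cases hJ : J.HasType .object
  · cases J with
    | obj names val => rw [validates_classicalSchema_obj, validates_modernSchema_obj]
    | _ => exact hJ.elim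
  · exact iff_of_true (validates_classicalSchema_of_not_obj hJ)
      (validates_modernSchema_of_not_obj hJ)

/-! ### Sizes -/

theorem Schema.total_mono {b b' : ℕ} {w w' : Keyword → ℕ} (hb : b ≤ b') (hw : ∀ K, w K ≤ w' K)
    (D : Schema) : D.total b w ≤ D.total b' w' := by
  match D with
  | .bool c => simpa only [Schema.total_bool] using hb
  | .obj ks =>
    rw [Schema.total_obj, Schema.total_obj]
    exact add_le_add hb (List.sum_le_sum fun K hK => add_le_add (hw K)
      (List.sum_le_sum fun S hS => Schema.total_mono hb hw S))
termination_by sizeOf D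
decreasing_by
  have h1 := Keyword.sizeOf_children hS
  have h2 := List.sizeOf_lt_of_mem hK
  simp only [Schema.obj.sizeOf_spec]
  omega

theorem Schema.keywordCount_le_size (D : Schema) : D.keywordCount ≤ D.size := by
  refine Schema.total_mono zero_le_one (fun K => ?_) D
  cases K with
  | ref u => cases u <;> exact Nat.le_add_right _ _
  | _ => first | exact Nat.le_add_right _ _ | (simp only [Keyword.localSize]; omega)

theorem keywordCount_modernSchema (n : ℕ) : (modernSchema n).keywordCount = 4 * n + 3 := by
  simp only [Schema.keywordCount, modernSchema, branch, nullSchema, Schema.total_obj,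
    Schema.total_bool, Keyword.children, List.map_cons, List.map_nil, List.map_map,
    Function.comp_def, List.sum_cons, List.sum_nil, List.map_const', List.sum_replicate,
    length_indices, smul_eq_mul]
  omega

theorem natSize_mono {m n : ℕ} (h : m ≤ n) : natSize m ≤ natSize n :=
  Nat.add_le_add_left (Nat.log_mono_right h) 1

theorem length_flag_le {n : ℕ} {x : ℕ × Bool} (hx : x.1 < n) :
    (flag x).length ≤ 3 + Nat.log 10 n := by
  have h₁ : 2 * x.1 + x.2.toNat ≤ n * 10 := by
    have := x.2.toNat_le
    omega
  have h₂ : (Nat.toDigits 10 (2 * x.1 + x.2.toNat)).length ≤ natSize (n * 10) := by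
    rw [Nat.length_toDigits_le_iff (by norm_num) (by simp [natSize])]
    refine h₁.trans_lt ?_
    rw [natSize, add_comm]
    exact Nat.lt_pow_succ_log_self (by norm_num) _
  rw [natSize, Nat.log_mul_base (by norm_num) (by omega)] at h₂
  rw [flag, String.length_ofList, List.length_cons]
  omega

theorem size_modernSchema_le (n : ℕ) :
    (modernSchema n).size ≤ 6 + n * 2 * (20 + 3 * Nat.log 10 n) := by
  have hb : ∀ x ∈ indices n, (branch x).size ≤ 20 + 3 * Nat.log 10 n := by
    intro x hx
    rw [mem_indices] at hx
    have h₁ := length_flag_le hx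
    have h₂ := natSize_mono hx.le
    simp only [natSize] at h₂
    simp only [Schema.size, branch, Schema.total_obj, Schema.total_bool, Keyword.children,
      Keyword.localSize, bitPattern, Pattern.size, natSize, List.map_cons, List.map_nil,
      List.sum_cons, List.sum_nil, Option.map_some, Option.getD_some]
    omega
  have hsum := List.sum_le_card_nsmul ((indices n).map fun x => (branch x).size)
    (20 + 3 * Nat.log 10 n) (by simpa only [List.forall_mem_map] using hb)
  rw [List.length_map, length_indices, smul_eq_mul] at hsum
  simp only [Schema.size] at hsum
  rw [Schema.size, modernSchema, nullSchema, Schema.total_obj]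
  simp only [Schema.total_obj, Schema.total_bool, Keyword.children, Keyword.localSize,
    List.map_cons, List.map_nil, List.map_map, Function.comp_def, List.sum_cons, List.sum_nil]
  omega

theorem keywordCount_modernSchema_isBigO :
    (fun n => ((modernSchema n).keywordCount : ℝ)) =O[Filter.atTop] fun n => (n : ℝ) := by
  refine Asymptotics.IsBigO.of_bound 7 ?_
  filter_upwards [Filter.eventually_ge_atTop 1] with n hn
  have : (1 : ℝ) ≤ n := by exact_mod_cast hn
  rw [keywordCount_modernSchema, Real.norm_natCast, Real.norm_natCast]
  push_cast
  linarith

theorem size_modernSchema_isBigO :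
    (fun n => ((modernSchema n).size : ℝ)) =O[Filter.atTop]
      fun n => (n : ℝ) * Real.log n := by
  have hexp : Real.exp 1 < 3 := Real.exp_one_lt_d9.trans (by norm_num)
  have hlog : ∀ x : ℝ, 3 ≤ x → 1 ≤ Real.log x := fun x hx =>
    (Real.le_log_iff_exp_le (by linarith)).2 (by linarith)
  -- For `n ≥ 3`, both factors of `n * log n` are at least `1`, and `52 ≥ 6 + 2 * 20 + 2 * 3`.
  refine Asymptotics.IsBigO.of_bound 52 ?_
  filter_upwards [Filter.eventually_ge_atTop 3] with n hn
  have hn' : (3 : ℝ) ≤ n := by exact_mod_cast hn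
  have h₁ := hlog n hn'
  have h₂ : (Nat.log 10 n : ℝ) ≤ Real.log n := by
    refine (Real.natLog_le_logb n 10).trans ?_
    rw [Real.logb]
    exact div_le_self (by linarith) (hlog _ (by norm_num))
  have h₃ : ((modernSchema n).size : ℝ) ≤ 6 + n * 2 * (20 + 3 * Nat.log 10 n) := by
    exact_mod_cast size_modernSchema_le n
  rw [Real.norm_natCast, Real.norm_of_nonneg (by positivity)]
  nlinarith [mul_le_mul_of_nonneg_left h₂ (by linarith : (0 : ℝ) ≤ n),
    mul_le_mul_of_nonneg_left h₁ (by linarith : (0 : ℝ) ≤ n)]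

/-! ### The lower bound -/

/-- Binary words, as strings. -/
def word {n : ℕ} (f : Fin n → Bool) : String := .ofList (List.ofFn fun i => bitChar (f i))

theorem getElem?_word {n : ℕ} (f : Fin n → Bool) (i : Fin n) :
    (word f).toList[i.1]? = some (bitChar (f i)) := by
  simp [word]

theorem word_injective {n : ℕ} : Function.Injective (word (n := n)) := by
  intro f g h
  funext i
  have := getElem?_word f i
  rw [h, getElem?_word, Option.some_inj] at this
  exact bitChar_injective this.symm

/-- All binary words of length `n`. -/
def words (n : ℕ) : Finset String := Finset.univ.image (word (n := n))

theorem card_words (n : ℕ) : (words n).card = 2 ^ n := by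
  rw [words, Finset.card_image_of_injective _ word_injective]
  simp

theorem flag_notMem_words {n : ℕ} (x : ℕ × Bool) : flag x ∉ words n := by
  simp only [words, Finset.mem_image, Finset.mem_univ, true_and, not_exists]
  intro f h
  have hx : Char.ofNat 120 ∈ (word f).toList := by simp [h, flag]
  simp only [word, String.toList_ofList, List.mem_ofFn] at hx
  obtain ⟨i, hi⟩ := hx
  cases hf : f i <;> rw [hf] at hi <;> revert hi <;> decide

/-- The flags that evaluate all words except for the word `f`. -/
def flagsAgainst {n : ℕ} (f : Fin n → Bool) : Finset String :=
  Finset.univ.image fun i : Fin n => flag (i.1, !f i)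

theorem validates_modernSchema_inst {n : ℕ} {A : Finset String} (hA : A ⊆ words n)
    (f : Fin n → Bool) :
    (modernSchema n).Validates (inst (words n) (flagsAgainst f) A) ↔ word f ∉ A := by
  rw [inst, validates_modernSchema_obj]
  constructor
  · intro h hf
    rcases h ⟨word f, Finset.mem_union_left _ (hA hf)⟩ with h | ⟨x, -, hx, hl⟩
    · simp [mark, hf] at h
    · have hx' := (Finset.mem_union.1 hx).resolve_left (flag_notMem_words x)
      obtain ⟨i, -, hi⟩ := Finset.mem_image.1 hx'
      obtain rfl := flag_injective hi
      rw [mem_lang_bitPattern, getElem?_word, Option.some_inj] at hl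
      simpa using bitChar_injective hl
  · rintro hf ⟨k, hk⟩
    by_cases hkA : k ∈ A
    · obtain ⟨g, -, rfl⟩ := Finset.mem_image.1 (hA hkA)
      obtain ⟨i, hi⟩ : ∃ i, g i ≠ f i := by
        by_contra! hc
        exact hf (funext hc ▸ hkA)
      refine Or.inr ⟨(i.1, g i), mem_indices.2 i.2, Finset.mem_union_right _ ?_, ?_⟩
      · refine Finset.mem_image.2 ⟨i, Finset.mem_univ _, ?_⟩
        rw [Bool.eq_not.2 hi]
      · exact mem_lang_bitPattern.2 (getElem?_word g i)
    · exact Or.inl (if_neg hkA)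

theorem two_pow_le_two_mul_keywordCount {n : ℕ} {T : Schema} (hT : T.IsClassical)
    (h : T.Equivalent (modernSchema n)) : 2 ^ n ≤ 2 * T.keywordCount := by
  rw [← card_words]
  refine card_le_two_mul_keywordCount hT _ fun A hA A' hA' hne => ?_
  obtain ⟨k, hk⟩ : ∃ k, ¬ (k ∈ A ↔ k ∈ A') := by
    by_contra! hc
    exact hne (Finset.ext hc)
  have hkw : k ∈ words n := by
    by_contra hkw
    exact hk (iff_of_false (fun h => hkw (hA h)) fun h => hkw (hA' h))
  obtain ⟨f, -, rfl⟩ := Finset.mem_image.1 hkw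
  refine ⟨flagsAgainst f, ?_⟩
  rw [h, h, validates_modernSchema_inst hA, validates_modernSchema_inst hA']
  exact fun h' => hk (not_iff_not.1 h')

end JSchema

theorem mainTheorem2 :
    ∃ S : ℕ → JSchema.Schema,
      (∀ n, (S n).IsStaticModern ∧ (S n).OneUnevaluatedProperties) ∧
      ((fun n => ((S n).keywordCount : ℝ)) =O[Filter.atTop] fun n => (n : ℝ)) ∧
      ((fun n => ((S n).size : ℝ)) =O[Filter.atTop] fun n => (n : ℝ) * Real.log n) ∧
      (∀ n, ∃ T : JSchema.Schema, T.IsClassical ∧ T.Equivalent (S n)) ∧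
      ∀ S' : ℕ → JSchema.Schema,
        (∀ n, (S' n).IsClassical ∧ (S' n).Equivalent (S n)) →
        ((fun n => (2 : ℝ) ^ n) =O[Filter.atTop] fun n => ((S' n).keywordCount : ℝ)) ∧
        ((fun n => (2 : ℝ) ^ n) =O[Filter.atTop] fun n => ((S' n).size : ℝ)) := by
  refine ⟨JSchema.modernSchema, fun n => ⟨(JSchema.refFree_modernSchema n).isStaticModern,
    JSchema.count_modernSchema n ⟨_, rfl⟩ ?_, JSchema.count_modernSchema n rfl fun _ h => h⟩,
    JSchema.keywordCount_modernSchema_isBigO, JSchema.size_modernSchema_isBigO,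
    fun n => ⟨_, JSchema.isClassical_classicalSchema n,
      JSchema.equivalent_classicalSchema_modernSchema n⟩, fun S' hS' => ?_⟩
  · rintro _ ⟨T, rfl⟩
    rfl
  · have hle : ∀ n, (2 : ℝ) ^ n ≤ 2 * (S' n).keywordCount := fun n => by
      exact_mod_cast JSchema.two_pow_le_two_mul_keywordCount (hS' n).1 (hS' n).2
    constructor <;> refine Asymptotics.IsBigO.of_bound 2 (.of_forall fun n => ?_)
    · rw [Real.norm_of_nonneg (by positivity), Real.norm_natCast]
      exact hle n
    · rw [Real.norm_of_nonneg (by positivity), Real.norm_natCast]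
      have : ((S' n).keywordCount : ℝ) ≤ (S' n).size := by
        exact_mod_cast (S' n).keywordCount_le_size
      linarith [hle n]
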